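/- Let $M$, $N$ be smooth connected (Hausdorff, second countable, finite-dimensional) manifolds with $p=\dim N\ge 1$, let $g_N$ be a Riemannian metric on $N$, and let $\pi:(M,g_0)\to(N,g_N)$ be a Riemannian submersion with totally geodesic fibers $\mathcal F_x=\pi^{-1}(\{x\})$. (All metrics, vector fields and families are smooth; surjectivity of $\pi$ is not required.) Put $\mathcal V=\ker\pi_*$. A *variation* of $g_0$ is a family $\{g_t\}_{t\in(-\epsilon,\epsilon)}$, $\epsilon>0$, of Riemannian metrics on $M$, smooth in $(t,x)$, starting at $g_0$, with $g_t(X,Y)=g_0(X,Y)$ for all $X,Y\in\mathcal V$; it is *non-trivial* if $g_t\ne g_0$ for some $t$. For each $t$ let $\nabla^t$ be the Levi-Civita connection of $g_t$, $P^t_{\mathcal H}$ the $g_t$-orthogonal projection onto the $g_t$-orthogonal complement of $\mathcal V$, and $h_t(X,Y)=P^t_{\mathcal H}\nabla^t_XY$ (for vertical $X,Y$) the second fundamental form of the fibers; the fibers are totally geodesic for $g_t$ if $h_t=0$. 1. If there is a non-trivial variation $\{g_t\}_{t\in(-\epsilon,\epsilon)}$ such that $\pi:(M,g_t)\to(N,g_N)$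 is a Riemannian submersion with totally geodesic fibers for all $t\in(-\epsilon,\epsilon)$, then there is a vertical vector field $\xi$ on $M$, not identically zero, whose restriction to $(\mathcal F_x,g_0|_{\mathcal F_x})$ is a Killing field for every $x\in N$. 2. Conversely, if there is a vertical vector field $\xi$ on $M$, not identically zero, with $g_0(\xi,\xi)$ bounded, whose restriction to $(\mathcal F_x,g_0|_{\mathcal F_x})$ is a Killing field for every $x\in N$, then there is a non-trivial variation $\{g_t\}_{t\in(-\epsilon,\epsilon)}$, for some $\epsilon>0$, such that $\pi:(M,g_t)\to(N,g_N)$ is a Riemannian submersion with totally geodesic fibers for all $t\in(-\epsilon,\epsilon)$. 3. Moreover, let $\{g_t\}_{t\in(-\epsilon,\epsilon)}$ be a variation such that $\pi:(M,g_t)\to(N,g_N)$ is a Riemannian submersion for all $t$. Let $W_1,\dots,W_p$ be pointwise linearly independent vector fields on an open set $U\subset N$ with $g_0$-horizontal lifts $\pi^*W_i$, and let $V_i(t)$, $1\le i\le p$, $t\in(-\epsilon,\epsilon)$, be vertical vector fields on $\pi^{-1}(U)$ such that $$B_t^\sharp X=\sum_{i=1}^p g_0(V_i(t),X)\,P^t_{\mathcal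 H}\pi^*W_i\qquad\text{for all } X\in\mathcal V \text{ over } U,\ t\in(-\epsilon,\epsilon),$$ where $B_t=\partial_tg_t$ and $g_t(B_t^\sharp X,Y)=B_t(X,Y)$. Then for all vertical vector fields $X,Y$ on $\pi^{-1}(U)$ (independent of $t$) and all $t\in(-\epsilon,\epsilon)$, the derivative $\partial_th_t(X,Y)$ exists at every point of $\pi^{-1}(U)$ and $$P^t_{\mathcal H}\,\partial_th_t(X,Y)=\tfrac12\sum_{i=1}^p(\mathcal L_{V_i(t)}g_0)(X,Y)\,P^t_{\mathcal H}\pi^*W_i .$$ -/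

import Mathlib

open Set Bundle Manifold VectorField
open scoped ContDiff Topology

noncomputable section

namespace RiemSubm

section Metric

variable {E : Type*} [NormedAddCommGroup E] [NormedSpace ℝ E]
  {M : Type*} [TopologicalSpace M] [ChartedSpace E M] [IsManifold 𝓘(ℝ, E) ∞ M]

variable (E M) in
/-- (Not necessarily smooth) vector fields on a manifold `M` modelled on `E`. -/
abbrev VField : Type _ := Π x : M, TangentSpace 𝓘(ℝ, E) x

/-- The vector field `X` is smooth on the set `s`. -/
def SmoothOn (X : VField E M) (s : Set M) : Prop :=
  ContMDiffOn 𝓘(ℝ, E) 𝓘(ℝ, E).tangent ∞ (fun x ↦ (X x : TangentBundle 𝓘(ℝ, E) M)) s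

/-- The vector field `X` is smooth. -/
def Smooth (X : VField E M) : Prop := SmoothOn X univ

variable (E M) in
/-- Smooth Riemannian metrics on the manifold `M` modelled on `E`. -/
abbrev Metric : Type _ :=
  ContMDiffRiemannianMetric 𝓘(ℝ, E) ∞ E (fun x : M ↦ TangentSpace 𝓘(ℝ, E) x)

instance tangentFiniteDimensional (x : M) [FiniteDimensional ℝ E] :
    FiniteDimensional ℝ (TangentSpace 𝓘(ℝ, E) x) :=
  inferInstanceAs (FiniteDimensional ℝ E)

instance tangentT2Space (x : M) : T2Space (TangentSpace 𝓘(ℝ, E) x) :=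
  inferInstanceAs (T2Space E)

/-- The scalar product `g x` on the tangent space at `x`, as a bilinear form. -/
def bilin (g : Metric E M) (x : M) : LinearMap.BilinForm ℝ (TangentSpace 𝓘(ℝ, E) x) :=
  LinearMap.mk₂ ℝ (fun v w ↦ g.inner x v w) (by simp) (by simp) (by simp) (by simp)

@[simp] lemma bilin_apply (g : Metric E M) (x : M) (v w : TangentSpace 𝓘(ℝ, E) x) :
    bilin g x v w = g.inner x v w := rfl

lemma bilin_isSymm (g : Metric E M) (x : M) : (bilin g x).IsSymm :=
  ⟨fun v w ↦ g.symm x v w⟩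

lemma bilin_restrict_nondegenerate (g : Metric E M) (x : M)
    (S : Submodule ℝ (TangentSpace 𝓘(ℝ, E) x)) : ((bilin g x).restrict S).Nondegenerate := by
  refine ⟨fun v hv ↦ ?_, fun v hv ↦ ?_⟩ <;>
  · by_contra hne
    have h1 := g.pos x (v : TangentSpace 𝓘(ℝ, E) x) (by simpa using hne)
    have h2 : g.inner x v v = 0 := hv v
    exact absurd h2 h1.ne'

lemma bilin_nondegenerate (g : Metric E M) (x : M) : (bilin g x).Nondegenerate := by
  refine ⟨fun v hv ↦ ?_, fun v hv ↦ ?_⟩ <;>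
  · by_contra hne
    exact absurd (hv v) (g.pos x v hne).ne'

lemma Metric.ext_inner (g : Metric E M) {x : M} {v w : TangentSpace 𝓘(ℝ, E) x}
    (h : ∀ u, g.inner x v u = g.inner x w u) : v = w := by
  by_contra hne
  have h1 := g.pos x (v - w) (sub_ne_zero.2 hne)
  have h2 := h (v - w)
  simp only [map_sub] at h1 h2
  simp at h1
  linarith

/-! ### The Levi-Civita connection -/

variable [FiniteDimensional ℝ E]

/-- The vector metrically dual to a linear form: `g (sharp g x φ, w) = φ w`. -/
def sharp (g : Metric E M) (x : M) :
    Module.Dual ℝ (TangentSpace 𝓘(ℝ, E) x) →ₗ[ℝ] TangentSpace 𝓘(ℝ, E) x :=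
  ((bilin g x).toDual (bilin_nondegenerate g x)).symm.toLinearMap

@[simp] lemma inner_sharp (g : Metric E M) (x : M) (φ : Module.Dual ℝ (TangentSpace 𝓘(ℝ, E) x))
    (w : TangentSpace 𝓘(ℝ, E) x) : g.inner x (sharp g x φ) w = φ w :=
  LinearMap.BilinForm.apply_toDual_symm_apply (hB := bilin_nondegenerate g x) φ w

/-- The derivative at `x` of the function `g(Y, Z)`. -/
def dInner (g : Metric E M) (Y Z : VField E M) (x : M) : TangentSpace 𝓘(ℝ, E) x →L[ℝ] ℝ :=
  mvfderiv 𝓘(ℝ, E) (fun y ↦ g.inner y (Y y) (Z y)) x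

/-- The Koszul expression
`½ (X g(Y,Z) + Y g(X,Z) - Z g(X,Y) + g([X,Y],Z) + g([Z,X],Y) + g([Z,Y],X))`. -/
def koszul (g : Metric E M) (X Y Z : VField E M) (x : M) : ℝ :=
  (1 / 2) * (dInner g Y Z x (X x) + dInner g X Z x (Y x) - dInner g X Y x (Z x)
    + g.inner x (mlieBracket 𝓘(ℝ, E) X Y x) (Z x)
    + g.inner x (mlieBracket 𝓘(ℝ, E) Z X x) (Y x)
    + g.inner x (mlieBracket 𝓘(ℝ, E) Z Y x) (X x))

lemma mdiffAt_inner (g : Metric E M) {Y Z : VField E M} {x : M}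
    (hY : MDiffAt (T% Y) x) (hZ : MDiffAt (T% Z) x) :
    MDiffAt (fun y ↦ g.inner y (Y y) (Z y)) x := by
  have h : MDifferentiableAt 𝓘(ℝ, E) (𝓘(ℝ, E).prod 𝓘(ℝ, ℝ))
      (fun y ↦ TotalSpace.mk' ℝ (E := Bundle.Trivial M ℝ) y (g.inner y (Y y) (Z y))) x :=
    MDifferentiableAt.clm_bundle_apply₂ (F₁ := E) (F₂ := E)
      (g.contMDiff.mdifferentiableAt (by simp)) hY hZ
  rw [mdifferentiableAt_totalSpace] at h
  exact h.2

lemma mdiffAt_extend {x : M} (v : TangentSpace 𝓘(ℝ, E) x) :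
    MDiffAt (T% (FiberBundle.extend E v)) x :=
  (FiberBundle.contMDiffAt_extend 𝓘(ℝ, E) E (k := 1) v).mdifferentiableAt one_ne_zero

lemma dInner_comm (g : Metric E M) (Y Z : VField E M) (x : M) :
    dInner g Y Z x = dInner g Z Y x := by
  unfold dInner
  congr 1
  ext y
  exact g.symm y _ _

lemma dInner_add_left (g : Metric E M) {Y Y' Z : VField E M} {x : M}
    (hY : MDiffAt (T% Y) x) (hY' : MDiffAt (T% Y') x) (hZ : MDiffAt (T% Z) x) :
    dInner g (Y + Y') Z x = dInner g Y Z x + dInner g Y' Z x := by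
  unfold dInner
  rw [← mvfderiv_add (mdiffAt_inner g hY hZ) (mdiffAt_inner g hY' hZ)]
  congr 1
  ext y
  simp

lemma dInner_smul_left (g : Metric E M) {Y Z : VField E M} {f : M → ℝ} {x : M}
    (hf : MDiffAt f x) (hY : MDiffAt (T% Y) x) (hZ : MDiffAt (T% Z) x) :
    dInner g (f • Y) Z x
      = f x • dInner g Y Z x + (mvfderiv 𝓘(ℝ, E) f x).smulRight (g.inner x (Y x) (Z x)) := by
  unfold dInner
  rw [← mvfderiv_smul hf (mdiffAt_inner g hY hZ)]
  congr 1
  ext y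
  simp

lemma koszul_tensorial_right (g : Metric E M) {X Y : VField E M} {x : M}
    (hX : MDiffAt (T% X) x) (hY : MDiffAt (T% Y) x) :
    TensorialAt 𝓘(ℝ, E) E (fun Z ↦ koszul g X Y Z x) x where
  smul {f Z} hf hZ := by
    simp only [koszul, dInner_comm g Y (f • Z), dInner_comm g X (f • Z),
      dInner_smul_left g hf hZ hY, dInner_smul_left g hf hZ hX,
      mlieBracket_smul_left hf hZ, dInner_comm g Z]
    simp [g.symm x (Z x)]
    ring
  add {Z Z'} hZ hZ' := by
    simp only [koszul, dInner_comm g Y (Z + Z'), dInner_comm g X (Z + Z'),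
      dInner_add_left g hZ hZ' hY, dInner_add_left g hZ hZ' hX,
      mlieBracket_add_left hZ hZ', dInner_comm g Z, dInner_comm g Z']
    simp
    ring

lemma koszul_tensorial_left (g : Metric E M) {Y Z : VField E M} {x : M}
    (hY : MDiffAt (T% Y) x) (hZ : MDiffAt (T% Z) x) :
    TensorialAt 𝓘(ℝ, E) E (fun X ↦ koszul g X Y Z x) x where
  smul {f X} hf hX := by
    simp only [koszul, dInner_smul_left g hf hX hY, dInner_smul_left g hf hX hZ,
      mlieBracket_smul_left hf hX, mlieBracket_smul_right hf hX]
    simp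
    ring
  add {X X'} hX hX' := by
    simp only [koszul, dInner_add_left g hX hX' hY, dInner_add_left g hX hX' hZ,
      mlieBracket_add_left hX hX', mlieBracket_add_right hX hX']
    simp
    ring

lemma koszul_add (g : Metric E M) {X Y Y' Z : VField E M} {x : M} (hX : MDiffAt (T% X) x)
    (hY : MDiffAt (T% Y) x) (hY' : MDiffAt (T% Y') x) (hZ : MDiffAt (T% Z) x) :
    koszul g X (Y + Y') Z x = koszul g X Y Z x + koszul g X Y' Z x := by
  simp only [koszul, dInner_comm g X (Y + Y'), dInner_add_left g hY hY' hX,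
    dInner_add_left g hY hY' hZ, mlieBracket_add_right hY hY']
  simp [dInner_comm g X]
  ring

lemma koszul_smul (g : Metric E M) {X Y Z : VField E M} {f : M → ℝ} {x : M}
    (hf : MDiffAt f x) (hX : MDiffAt (T% X) x)
    (hY : MDiffAt (T% Y) x) (hZ : MDiffAt (T% Z) x) :
    koszul g X (f • Y) Z x = f x * koszul g X Y Z x
      + mvfderiv 𝓘(ℝ, E) f x (X x) * g.inner x (Y x) (Z x) := by
  simp only [koszul, dInner_comm g X (f • Y), dInner_smul_left g hf hY hX,
    dInner_smul_left g hf hY hZ, mlieBracket_smul_right hf hY]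
  simp [dInner_comm g X, g.symm x (Y x)]
  ring

open scoped Classical in
/-- The Levi-Civita connection of `g`, defined by the Koszul formula; `leviCivita g Y x (X x)` is
`(∇_X Y) x`. (Nondifferentiable fields `Y` are sent to the junk value `0`.) -/
def leviCivita (g : Metric E M) :
    CovariantDerivative 𝓘(ℝ, E) E (fun x : M ↦ TangentSpace 𝓘(ℝ, E) x) where
  toFun Y x :=
    if hY : MDiffAt (T% Y) x then
      LinearMap.toContinuousLinearMap (sharp g x ∘ₗ ContinuousLinearMap.coeLM ℝ ∘ₗ
        (TensorialAt.mkHom₂ (I := 𝓘(ℝ, E)) (F := E) (F' := E) (fun X Z ↦ koszul g X Y Z x) x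
          (fun _ hZ ↦ koszul_tensorial_left g hY hZ)
          (fun _ hX ↦ koszul_tensorial_right g hX hY)).toLinearMap)
    else 0
  isCovariantDerivativeOnUniv := by
    constructor
    · intro Y Y' x hY hY' _
      have hs : MDiffAt (T% (Y + Y')) x := mdifferentiableAt_add_section hY hY'
      ext v
      refine g.ext_inner fun w ↦ ?_
      simp only [hs, hY, hY', dif_pos]
      simp [TensorialAt.mkHom₂_apply_eq_extend]
      exact koszul_add g (mdiffAt_extend _) hY hY' (mdiffAt_extend _)
    · intro Y f x hY hf _
      have hs : MDiffAt (T% (f • Y)) x := hf.smul_section hY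
      ext v
      refine g.ext_inner fun w ↦ ?_
      simp only [hs, hY, dif_pos]
      simp [TensorialAt.mkHom₂_apply_eq_extend]
      rw [koszul_smul g hf (mdiffAt_extend _) hY (mdiffAt_extend _)]
      simp

/-- The Koszul formula. -/
lemma inner_leviCivita (g : Metric E M) {X Y Z : VField E M} {x : M} (hX : MDiffAt (T% X) x)
    (hY : MDiffAt (T% Y) x) (hZ : MDiffAt (T% Z) x) :
    g.inner x (leviCivita g Y x (X x)) (Z x) = koszul g X Y Z x := by
  simp only [leviCivita, hY, dif_pos]
  simp
  exact TensorialAt.mkHom₂_apply (I := 𝓘(ℝ, E)) (F := E) (F' := E) _ _ hX hZ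

/-- The Levi-Civita connection is torsion free. -/
lemma leviCivita_torsion (g : Metric E M) {X Y : VField E M} {x : M} (hX : MDiffAt (T% X) x)
    (hY : MDiffAt (T% Y) x) :
    leviCivita g Y x (X x) - leviCivita g X x (Y x) = mlieBracket 𝓘(ℝ, E) X Y x := by
  refine g.ext_inner fun w ↦ ?_
  have hw : MDiffAt (T% (FiberBundle.extend E w)) x := mdiffAt_extend w
  have h1 := inner_leviCivita g hX hY hw
  have h2 := inner_leviCivita g hY hX hw
  simp only [FiberBundle.extend_apply_self] at h1 h2
  simp [h1, h2, koszul, dInner_comm g Y X, mlieBracket_swap_apply (V := Y) (W := X)]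
  ring

/-- The Levi-Civita connection is metric. -/
lemma leviCivita_metric (g : Metric E M) {X Y Z : VField E M} {x : M} (hX : MDiffAt (T% X) x)
    (hY : MDiffAt (T% Y) x) (hZ : MDiffAt (T% Z) x) :
    dInner g Y Z x (X x)
      = g.inner x (leviCivita g Y x (X x)) (Z x) + g.inner x (Y x) (leviCivita g Z x (X x)) := by
  rw [g.symm x (Y x), inner_leviCivita g hX hY hZ, inner_leviCivita g hX hZ hY]
  simp [koszul, dInner_comm g Z Y,
    mlieBracket_swap_apply (V := Y) (W := X), mlieBracket_swap_apply (V := Z) (W := X),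
    mlieBracket_swap_apply (V := Z) (W := Y)]
  ring

/-- The Lie derivative of the metric:
`(L_ξ g)(X, Y) = ξ g(X, Y) - g([ξ, X], Y) - g(X, [ξ, Y])`. -/
def lieDerivMetric (g : Metric E M) (ξ X Y : VField E M) (x : M) : ℝ :=
  dInner g X Y x (ξ x) - g.inner x (mlieBracket 𝓘(ℝ, E) ξ X x) (Y x)
    - g.inner x (X x) (mlieBracket 𝓘(ℝ, E) ξ Y x)

/-- The vector field `X` is bounded: `g(X, X)` is a bounded function. -/
def IsBounded (g : Metric E M) (X : VField E M) : Prop :=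
  ∃ C : ℝ, ∀ x, g.inner x (X x) (X x) ≤ C

/-- A smooth family `g t`, `t ∈ (-ε, ε)`, of Riemannian metrics: `(t, x) ↦ g t x` is a smooth map
from `(-ε, ε) × M` to the bundle of bilinear forms on the tangent spaces of `M`.
The values `g t` for `t` outside of `(-ε, ε)` are irrelevant. -/
def SmoothFamily (ε : ℝ) (g : ℝ → Metric E M) : Prop :=
  ContMDiffOn (𝓘(ℝ, ℝ).prod 𝓘(ℝ, E)) (𝓘(ℝ, E).prod 𝓘(ℝ, E →L[ℝ] E →L[ℝ] ℝ)) ∞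
    (fun p : ℝ × M ↦ (TotalSpace.mk' (E →L[ℝ] E →L[ℝ] ℝ) p.2 ((g p.1).inner p.2) :
      TotalSpace (E →L[ℝ] E →L[ℝ] ℝ)
        (fun x : M ↦ TangentSpace 𝓘(ℝ, E) x →L[ℝ] TangentSpace 𝓘(ℝ, E) x →L[ℝ] ℝ)))
    (Ioo (-ε) ε ×ˢ univ)

end Metric

section Submersion

variable {E : Type*} [NormedAddCommGroup E] [NormedSpace ℝ E] [FiniteDimensional ℝ E]
  {M : Type*} [TopologicalSpace M] [ChartedSpace E M] [IsManifold 𝓘(ℝ, E) ∞ M]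
  {F : Type*} [NormedAddCommGroup F] [NormedSpace ℝ F]
  {N : Type*} [TopologicalSpace N] [ChartedSpace F N]

variable (E F) in
/-- The vertical space at `x`: the kernel of the differential of `pr`. -/
def vert (pr : M → N) (x : M) : Submodule ℝ (TangentSpace 𝓘(ℝ, E) x) :=
  (mfderiv 𝓘(ℝ, E) 𝓘(ℝ, F) pr x).toLinearMap.ker

variable (F) in
/-- The `g`-horizontal space at `x`: the `g`-orthogonal complement of the vertical space. -/
def horiz (g : Metric E M) (pr : M → N) (x : M) : Submodule ℝ (TangentSpace 𝓘(ℝ, E) x) :=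
  (bilin g x).orthogonal (vert E F pr x)

lemma isCompl_horiz_vert (g : Metric E M) (pr : M → N) (x : M) :
    IsCompl (horiz F g pr x) (vert E F pr x) :=
  ((bilin g x).isCompl_orthogonal_of_restrict_nondegenerate (bilin_isSymm g x).isRefl
    (bilin_restrict_nondegenerate g x (vert E F pr x))).symm

variable (F) in
/-- The `g`-orthogonal projection of the tangent space at `x` onto the horizontal space. -/
def horizProj (g : Metric E M) (pr : M → N) (x : M) :
    TangentSpace 𝓘(ℝ, E) x →ₗ[ℝ] TangentSpace 𝓘(ℝ, E) x :=
  (horiz F g pr x).projection (vert E F pr x) (isCompl_horiz_vert g pr x)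

/-- `pr : (M, g) → (N, gN)` is a Riemannian submersion: a smooth map of rank `dim N` whose
differential is isometric on the vectors orthogonal to the fibers. -/
structure IsRiemannianSubmersion [IsManifold 𝓘(ℝ, F) ∞ N]
    (g : Metric E M) (gN : Metric F N) (pr : M → N) : Prop where
  smooth : ContMDiff 𝓘(ℝ, E) 𝓘(ℝ, F) ∞ pr
  surjective : ∀ x, Function.Surjective (mfderiv 𝓘(ℝ, E) 𝓘(ℝ, F) pr x)
  isometry : ∀ x, ∀ X ∈ horiz F g pr x, ∀ Y ∈ horiz F g pr x,
    g.inner x X Y = gN.inner (pr x)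
      (mfderiv 𝓘(ℝ, E) 𝓘(ℝ, F) pr x X) (mfderiv 𝓘(ℝ, E) 𝓘(ℝ, F) pr x Y)

variable (F) in
/-- The vector field `X` is vertical on the set `s`. -/
def IsVerticalOn (pr : M → N) (X : VField E M) (s : Set M) : Prop :=
  ∀ x ∈ s, X x ∈ vert E F pr x

variable (F) in
/-- `X` is a (smooth, globally defined) vertical vector field. -/
def IsVerticalField (pr : M → N) (X : VField E M) : Prop :=
  Smooth X ∧ IsVerticalOn F pr X univ

variable (F) in
/-- The second fundamental form of the fibers, `h(X, Y) = P_H ∇_X Y` for vertical `X`, `Y`. -/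
def secondFF (g : Metric E M) (pr : M → N) (X Y : VField E M) (x : M) : TangentSpace 𝓘(ℝ, E) x :=
  horizProj F g pr x (leviCivita g Y x (X x))

variable (F) in
/-- The fibers of `pr` are totally geodesic in `(M, g)`. -/
def TotallyGeodesicFibers (g : Metric E M) (pr : M → N) : Prop :=
  ∀ X Y : VField E M, IsVerticalField F pr X → IsVerticalField F pr Y →
    ∀ x, secondFF F g pr X Y x = 0

variable (F) in
/-- The restriction of the vertical field `ξ` to the fiber `pr⁻¹(y)`, with the metric induced
by `g`, is a Killing field: the Lie derivative of the induced metric vanishes. Smooth fields on the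
fiber are, near each point, restrictions of vertical fields of `M`, and for vertical fields both
the Lie brackets and the derivatives of functions along them are computed in the fiber. -/
def IsKillingOnFiber (g : Metric E M) (pr : M → N) (ξ : VField E M) (y : N) : Prop :=
  ∀ X Y : VField E M, IsVerticalField F pr X → IsVerticalField F pr Y →
    ∀ x ∈ pr ⁻¹' {y}, lieDerivMetric g ξ X Y x = 0

variable (F) in
/-- `g t`, `t ∈ (-ε, ε)`, is a variation of `g₀` in the set `Riem(M, V, g₀)` of the metrics which
agree with `g₀` on the vertical distribution `V = ker d pr`. -/
structure IsVariation (g₀ : Metric E M) (pr : M → N) (ε : ℝ) (g : ℝ → Metric E M) : Prop where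
  pos : 0 < ε
  smooth : SmoothFamily ε g
  zero : g 0 = g₀
  vertical : ∀ t ∈ Ioo (-ε) ε, ∀ x, ∀ X ∈ vert E F pr x, ∀ Y ∈ vert E F pr x,
    (g t).inner x X Y = g₀.inner x X Y

/-- The variation `g t`, `t ∈ (-ε, ε)`, of `g₀` is non-trivial. -/
def NontrivialVariation (g₀ : Metric E M) (ε : ℝ) (g : ℝ → Metric E M) : Prop :=
  ∃ t ∈ Ioo (-ε) ε, g t ≠ g₀

/-- The vector `B_t^♯ X`, where `B_t = ∂_t g_t` and `g_t (B_t^♯ X, Y) = B_t (X, Y)`. -/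
def Bsharp (g : ℝ → Metric E M) (t : ℝ) (x : M) (X : TangentSpace 𝓘(ℝ, E) x) :
    TangentSpace 𝓘(ℝ, E) x :=
  sharp (g t) x (deriv (fun s ↦ (g s).inner x X) t : TangentSpace 𝓘(ℝ, E) x →L[ℝ] ℝ)

/-- The `g`-horizontal lift of the vector field `W`: the horizontal part of any vector over `W`. -/
def horizLift (g : Metric E M) (pr : M → N) (W : VField F N) : VField E M :=
  fun x ↦ horizProj F g pr x
    (Function.invFun (mfderiv 𝓘(ℝ, E) 𝓘(ℝ, F) pr x) (W (pr x)))

end Submersion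

end RiemSubm

end

noncomputable section

namespace RiemSubm

section BundleSmoothness

open ContinuousLinearMap

variable {E' : Type*} [NormedAddCommGroup E'] [NormedSpace ℝ E']
  {H' : Type*} [TopologicalSpace H'] {I' : ModelWithCorners ℝ E' H'}
  {P : Type*} [TopologicalSpace P] [ChartedSpace H' P] {n : WithTop ℕ∞}

lemma contMDiffAt_clm_of_apply {F₁ F₂ : Type*} [NormedAddCommGroup F₁] [NormedSpace ℝ F₁]
    [FiniteDimensional ℝ F₁] [NormedAddCommGroup F₂] [NormedSpace ℝ F₂]
    {f : P → F₁ →L[ℝ] F₂} {p : P}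
    (hf : ∀ v, ContMDiffAt I' 𝓘(ℝ, F₂) n (fun q ↦ f q v) p) :
    ContMDiffAt I' 𝓘(ℝ, F₁ →L[ℝ] F₂) n f p := by
  let b := Module.finBasis ℝ F₁
  let c : Fin (Module.finrank ℝ F₁) → F₁ →L[ℝ] ℝ := fun i ↦ (b.coord i).toContinuousLinearMap
  have h : f = fun q ↦ ∑ i, ContinuousLinearMap.smulRightL ℝ F₁ F₂ (c i) (f q (b i)) := by
    ext q v
    have := congrArg (f q) (b.sum_repr v)
    simp only [map_sum, map_smul] at this
    simp [← this, c]
  rw [h]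
  refine ContMDiffAt.sum fun i _ ↦ ?_
  exact (ContinuousLinearMap.contDiff _).contMDiff.contMDiffAt.comp p (hf (b i))

variable {EB : Type*} [NormedAddCommGroup EB] [NormedSpace ℝ EB]
  {HB : Type*} [TopologicalSpace HB] {IB : ModelWithCorners ℝ EB HB}
  {B : Type*} [TopologicalSpace B] [ChartedSpace HB B]
  {F₁ F₂ : Type*} [NormedAddCommGroup F₁] [NormedSpace ℝ F₁] [FiniteDimensional ℝ F₁]
  [NormedAddCommGroup F₂] [NormedSpace ℝ F₂]
  {V₁ : B → Type*} [∀ x, AddCommGroup (V₁ x)] [∀ x, Module ℝ (V₁ x)]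
  [TopologicalSpace (TotalSpace F₁ V₁)] [∀ x, TopologicalSpace (V₁ x)]
  [FiberBundle F₁ V₁] [VectorBundle ℝ F₁ V₁]
  {V₂ : B → Type*} [∀ x, AddCommGroup (V₂ x)] [∀ x, Module ℝ (V₂ x)]
  [TopologicalSpace (TotalSpace F₂ V₂)] [∀ x, TopologicalSpace (V₂ x)]
  [∀ x, IsTopologicalAddGroup (V₂ x)] [∀ x, ContinuousSMul ℝ (V₂ x)]
  [FiberBundle F₂ V₂] [VectorBundle ℝ F₂ V₂]
  {h : P → B} {p : P}

/-- A family of linear maps between the fibers of two vector bundles is smooth if it maps smooth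
sections to smooth sections. -/
lemma contMDiffAt_hom_of_apply [ContMDiffVectorBundle n F₁ V₁ IB]
    {φ : ∀ q, V₁ (h q) →L[ℝ] V₂ (h q)} (hh : ContMDiffAt I' IB n h p)
    (hφ : ∀ v : ∀ q, V₁ (h q),
      ContMDiffAt I' (IB.prod 𝓘(ℝ, F₁)) n (fun q ↦ TotalSpace.mk' F₁ (h q) (v q)) p →
      ContMDiffAt I' (IB.prod 𝓘(ℝ, F₂)) n (fun q ↦ TotalSpace.mk' F₂ (h q) (φ q (v q))) p) :
    ContMDiffAt I' (IB.prod 𝓘(ℝ, F₁ →L[ℝ] F₂)) n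
      (fun q ↦ TotalSpace.mk' (F₁ →L[ℝ] F₂) (E := fun x ↦ V₁ x →L[ℝ] V₂ x) (h q) (φ q)) p := by
  rw [contMDiffAt_hom_bundle]
  refine ⟨hh, contMDiffAt_clm_of_apply fun w ↦ ?_⟩
  set e := trivializationAt F₁ V₁ (h p)
  have hmem : ∀ᶠ q in 𝓝 p, h q ∈ e.baseSet :=
    hh.continuousAt (e.open_baseSet.mem_nhds (FiberBundle.mem_baseSet_trivializationAt' (h p)))
  have hmem₂ : ∀ᶠ q in 𝓝 p, h q ∈ (trivializationAt F₂ V₂ (h p)).baseSet :=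
    hh.continuousAt ((trivializationAt F₂ V₂ (h p)).open_baseSet.mem_nhds
      (FiberBundle.mem_baseSet_trivializationAt' (h p)))
  have hv : ContMDiffAt I' (IB.prod 𝓘(ℝ, F₁)) n
      (fun q ↦ TotalSpace.mk' F₁ (h q) (e.symmL ℝ (h q) w)) p := by
    rw [contMDiffAt_totalSpace]
    refine ⟨hh, (contMDiffAt_const (c := w)).congr_of_eventuallyEq ?_⟩
    filter_upwards [hmem] with q hq
    simp [e, e.symmL_apply hq, hq]
  have := (contMDiffAt_totalSpace.1 (hφ _ hv)).2
  refine this.congr_of_eventuallyEq ?_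
  filter_upwards [hmem, hmem₂] with q hq hq₂
  rw [inCoordinates_eq hq hq₂]
  simp [e.symmL_apply hq, e]

/-- If an invertible smooth bundle map sends a section to a smooth section, this section is
smooth. -/
lemma contMDiffAt_of_clm_apply [FiniteDimensional ℝ F₂]
    {φ : ∀ q, V₁ (h q) →L[ℝ] V₂ (h q)} {v : ∀ q, V₁ (h q)}
    (hφ : ContMDiffAt I' (IB.prod 𝓘(ℝ, F₁ →L[ℝ] F₂)) n
      (fun q ↦ TotalSpace.mk' (F₁ →L[ℝ] F₂) (E := fun x ↦ V₁ x →L[ℝ] V₂ x) (h q) (φ q)) p)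
    (hinv : ∀ᶠ q in 𝓝 p, Function.Bijective (φ q))
    (hv : ContMDiffAt I' (IB.prod 𝓘(ℝ, F₂)) n (fun q ↦ TotalSpace.mk' F₂ (h q) (φ q (v q))) p) :
    ContMDiffAt I' (IB.prod 𝓘(ℝ, F₁)) n (fun q ↦ TotalSpace.mk' F₁ (h q) (v q)) p := by
  rw [contMDiffAt_hom_bundle] at hφ
  obtain ⟨hh, hφ⟩ := hφ
  rw [contMDiffAt_totalSpace] at hv ⊢
  refine ⟨hh, ?_⟩
  set e := trivializationAt F₁ V₁ (h p)
  set e₂ := trivializationAt F₂ V₂ (h p)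
  have hmem : ∀ᶠ q in 𝓝 p, h q ∈ e.baseSet :=
    hh.continuousAt (e.open_baseSet.mem_nhds (FiberBundle.mem_baseSet_trivializationAt' (h p)))
  have hmem₂ : ∀ᶠ q in 𝓝 p, h q ∈ e₂.baseSet :=
    hh.continuousAt (e₂.open_baseSet.mem_nhds (FiberBundle.mem_baseSet_trivializationAt' (h p)))
  set G : P → F₁ →L[ℝ] F₂ := fun q ↦ inCoordinates F₁ V₁ F₂ V₂ (h p) (h q) (h p) (h q) (φ q)
  have hG : ∀ᶠ q in 𝓝 p, (G q).IsInvertible := by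
    filter_upwards [hmem, hmem₂, hinv] with q hq hq₂ hb
    have hbij : Function.Bijective (G q) := by
      simp only [G, inCoordinates_eq hq hq₂, coe_comp]
      exact (ContinuousLinearEquiv.bijective _).comp
        (hb.comp (ContinuousLinearEquiv.bijective _))
    exact ⟨(LinearEquiv.ofBijective (G q).toLinearMap hbij).toContinuousLinearEquiv, rfl⟩
  have h1 : ContMDiffAt I' 𝓘(ℝ, F₂ →L[ℝ] F₁) n (fun q ↦ (G q).inverse) p :=
    (ContDiffAt.contMDiffAt (hG.self_of_nhds.contDiffAt_map_inverse)).comp p hφ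
  refine (h1.clm_apply hv.2).congr_of_eventuallyEq ?_
  filter_upwards [hmem, hmem₂, hG] with q hq hq₂ hinv
  symm
  rw [hinv.inverse_apply_eq]
  simp only [G]
  rw [inCoordinates_eq hq hq₂]
  simp [e, e₂, hq]

end BundleSmoothness

section Curves

/-- The mixed second partial derivatives of a smooth function on the plane agree. -/
lemma hasDerivAt_deriv_comm {F : ℝ × ℝ → ℝ} {t r : ℝ} (hF : ContDiffAt ℝ 2 F (t, r)) :
    HasDerivAt (fun s ↦ deriv (fun u ↦ F (s, u)) r) (deriv (fun u ↦ deriv (fun s ↦ F (s, u)) t) r)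
      t := by
  have hd : ∀ᶠ q in 𝓝 (t, r), DifferentiableAt ℝ F q :=
    (hF.eventually (by simp)).mono fun q hq ↦ hq.differentiableAt (by simp)
  have hd2 : DifferentiableAt ℝ (fderiv ℝ F) (t, r) :=
    (hF.fderiv_right (m := 1) (by norm_num)).differentiableAt (by simp)
  have hsymm := (hF.isSymmSndFDerivAt (by simp)).eq (1, 0) (0, 1)
  have e1 : (fun s ↦ deriv (fun u ↦ F (s, u)) r) =ᶠ[𝓝 t] fun s ↦ fderiv ℝ F (s, r) (0, 1) := by
    have hc : Filter.Tendsto (fun s : ℝ ↦ (s, r)) (𝓝 t) (𝓝 (t, r)) :=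
      Continuous.tendsto (by fun_prop) t
    filter_upwards [hc.eventually hd] with s hs
    have := hs.hasFDerivAt.comp_hasDerivAt r ((hasDerivAt_const r s).prodMk (hasDerivAt_id r))
    exact this.deriv
  have e2 : (fun u ↦ deriv (fun s ↦ F (s, u)) t) =ᶠ[𝓝 r] fun u ↦ fderiv ℝ F (t, u) (1, 0) := by
    have hc : Filter.Tendsto (fun u : ℝ ↦ (t, u)) (𝓝 r) (𝓝 (t, r)) :=
      Continuous.tendsto (by fun_prop) r
    filter_upwards [hc.eventually hd] with u hu
    have := hu.hasFDerivAt.comp_hasDerivAt t ((hasDerivAt_id t).prodMk (hasDerivAt_const t u))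
    exact this.deriv
  have d1 : HasDerivAt (fun s ↦ fderiv ℝ F (s, r)) (fderiv ℝ (fderiv ℝ F) (t, r) (1, 0)) t :=
    hd2.hasFDerivAt.comp_hasDerivAt t ((hasDerivAt_id t).prodMk (hasDerivAt_const t r))
  have d2 : HasDerivAt (fun u ↦ fderiv ℝ F (t, u)) (fderiv ℝ (fderiv ℝ F) (t, r) (0, 1)) r :=
    hd2.hasFDerivAt.comp_hasDerivAt r ((hasDerivAt_const r t).prodMk (hasDerivAt_id r))
  have d2' := (d2.clm_apply (hasDerivAt_const r ((1 : ℝ), (0 : ℝ)))).congr_of_eventuallyEq e2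
  have d1' := (d1.clm_apply (hasDerivAt_const t ((0 : ℝ), (1 : ℝ)))).congr_of_eventuallyEq e1
  rw [d2'.deriv]
  simpa [hsymm] using d1'

variable {E : Type*} [NormedAddCommGroup E] [NormedSpace ℝ E]
  {M : Type*} [TopologicalSpace M] [ChartedSpace E M] [IsManifold 𝓘(ℝ, E) ∞ M]

/-- Every tangent vector is the velocity of a smooth curve. -/
lemma exists_curve (x : M) (v : TangentSpace 𝓘(ℝ, E) x) :
    ∃ γ : ℝ → M, γ 0 = x ∧ ContMDiffAt 𝓘(ℝ, ℝ) 𝓘(ℝ, E) ∞ γ 0 ∧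
      ∀ u : M → ℝ, MDiffAt u x →
        HasDerivAt (fun r ↦ u (γ r)) (mvfderiv 𝓘(ℝ, E) u x v) 0 := by
  set w : E := mfderiv 𝓘(ℝ, E) 𝓘(ℝ, E) (extChartAt 𝓘(ℝ, E) x) x v
  set c : ℝ → E := fun r ↦ extChartAt 𝓘(ℝ, E) x x + r • w
  have hc : HasDerivAt c w 0 := by
    have := ((hasDerivAt_id (0 : ℝ)).smul_const w).const_add (extChartAt 𝓘(ℝ, E) x x)
    rw [one_smul] at this
    exact this
  have hc0 : c 0 = extChartAt 𝓘(ℝ, E) x x := by simp [c]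
  have hcs : ContMDiffAt 𝓘(ℝ, ℝ) 𝓘(ℝ, E) ∞ c 0 := by
    apply ContDiffAt.contMDiffAt
    fun_prop
  have hs : ContMDiffAt 𝓘(ℝ, E) 𝓘(ℝ, E) ∞ (extChartAt 𝓘(ℝ, E) x).symm (c 0) := by
    rw [hc0]
    exact (contMDiffOn_extChartAt_symm x).contMDiffAt (extChartAt_target_mem_nhds x)
  refine ⟨(extChartAt 𝓘(ℝ, E) x).symm ∘ c, by simp [hc0], hs.comp 0 hcs, fun u hu ↦ ?_⟩
  have hsd : MDifferentiableAt 𝓘(ℝ, E) 𝓘(ℝ, E) (extChartAt 𝓘(ℝ, E) x).symm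
      (extChartAt 𝓘(ℝ, E) x x) := hc0 ▸ hs.mdifferentiableAt (by simp)
  have hud : MDifferentiableAt 𝓘(ℝ, E) 𝓘(ℝ, ℝ) (u ∘ (extChartAt 𝓘(ℝ, E) x).symm)
      (extChartAt 𝓘(ℝ, E) x x) := by
    refine MDifferentiableAt.comp _ ?_ hsd
    simpa using hu
  have hud' := hud.differentiableAt.hasFDerivAt
  have key : fderiv ℝ (u ∘ (extChartAt 𝓘(ℝ, E) x).symm) (extChartAt 𝓘(ℝ, E) x x) w
      = mvfderiv 𝓘(ℝ, E) u x v := by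
    have heq : u =ᶠ[𝓝 x] (u ∘ (extChartAt 𝓘(ℝ, E) x).symm) ∘ extChartAt 𝓘(ℝ, E) x := by
      filter_upwards [extChartAt_source_mem_nhds (I := 𝓘(ℝ, E)) x] with y hy
      rw [Function.comp_apply, Function.comp_apply, (extChartAt 𝓘(ℝ, E) x).left_inv hy]
    have h1 : mfderiv 𝓘(ℝ, E) 𝓘(ℝ, ℝ) u x v
        = mfderiv 𝓘(ℝ, E) 𝓘(ℝ, ℝ) ((u ∘ (extChartAt 𝓘(ℝ, E) x).symm) ∘ extChartAt 𝓘(ℝ, E) x) x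
          v := by rw [heq.mfderiv_eq]; rfl
    rw [mfderiv_comp x hud ((contMDiffAt_extChartAt (n := 1)).mdifferentiableAt (by simp)),
      mfderiv_eq_fderiv] at h1
    exact h1.symm
  rw [← key]
  rw [← hc0] at hud' ⊢
  exact hud'.comp_hasDerivAt (0 : ℝ) hc

/-- The derivative in `t` of the differential of a function depending on a parameter `t`. -/
lemma hasDerivAt_mvfderiv_comm {f : ℝ × M → ℝ} {t : ℝ} {x : M}
    (hf : ContMDiffAt (𝓘(ℝ, ℝ).prod 𝓘(ℝ, E)) 𝓘(ℝ, ℝ) ∞ f (t, x))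
    {f' : M → ℝ} (hf' : ∀ᶠ y in 𝓝 x, HasDerivAt (fun s ↦ f (s, y)) (f' y) t)
    (hfd : MDiffAt f' x) (v : TangentSpace 𝓘(ℝ, E) x) :
    HasDerivAt (fun s ↦ mvfderiv 𝓘(ℝ, E) (fun y ↦ f (s, y)) x v) (mvfderiv 𝓘(ℝ, E) f' x v) t := by
  obtain ⟨γ, h0, hγ, hu⟩ := exists_curve x v
  have hF : ContDiffAt ℝ 2 (fun q : ℝ × ℝ ↦ f (q.1, γ q.2)) (t, 0) := by
    have h1 : ContMDiffAt (𝓘(ℝ, ℝ).prod 𝓘(ℝ, ℝ)) (𝓘(ℝ, ℝ).prod 𝓘(ℝ, E)) ∞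
        (fun q : ℝ × ℝ ↦ (q.1, γ q.2)) (t, 0) :=
      contMDiffAt_fst.prodMk (ContMDiffAt.comp (t, (0 : ℝ)) hγ contMDiffAt_snd)
    have h2 : ContMDiffAt (𝓘(ℝ, ℝ).prod 𝓘(ℝ, ℝ)) 𝓘(ℝ, ℝ) ∞
        (fun q : ℝ × ℝ ↦ f (q.1, γ q.2)) (t, 0) :=
      ContMDiffAt.comp (t, (0 : ℝ)) (h0.symm ▸ hf) h1
    rw [← modelWithCornersSelf_prod, chartedSpaceSelf_prod] at h2
    exact h2.contDiffAt.of_le (by norm_cast)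
  have h := hasDerivAt_deriv_comm hF
  have e1 : deriv (fun u ↦ deriv (fun s ↦ f (s, γ u)) t) 0 = mvfderiv 𝓘(ℝ, E) f' x v := by
    rw [← (hu f' hfd).deriv]
    apply Filter.EventuallyEq.deriv_eq
    have := hγ.continuousAt
    rw [ContinuousAt, h0] at this
    filter_upwards [this.eventually hf'] with r hr
    exact hr.deriv
  simp only at h
  rw [e1] at h
  refine h.congr_of_eventuallyEq ?_
  have hev : ∀ᶠ s in 𝓝 t, MDiffAt (fun y ↦ f (s, y)) x := by
    have h1 : ∀ᶠ q in 𝓝 (t, x), ContMDiffAt (𝓘(ℝ, ℝ).prod 𝓘(ℝ, E)) 𝓘(ℝ, ℝ) 1 f q :=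
      (contMDiffAt_iff_contMDiffAt_nhds (by simp)).1
        (hf.of_le (m := 1) (by norm_cast))
    have hc : Filter.Tendsto (fun s : ℝ ↦ (s, x)) (𝓝 t) (𝓝 (t, x)) :=
      Continuous.tendsto (by fun_prop) t
    filter_upwards [hc.eventually h1] with s hs
    exact (ContMDiffAt.comp x hs (contMDiffAt_const.prodMk contMDiffAt_id)).mdifferentiableAt
      (by simp)
  filter_upwards [hev] with s hs
  exact (hu _ hs).deriv.symm

end Curves

section TangentSections

variable {E' : Type*} [NormedAddCommGroup E'] [NormedSpace ℝ E']
  {H' : Type*} [TopologicalSpace H'] {I' : ModelWithCorners ℝ E' H'}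
  {P : Type*} [TopologicalSpace P] [ChartedSpace H' P]
  {E : Type*} [NormedAddCommGroup E] [NormedSpace ℝ E]
  {M : Type*} [TopologicalSpace M] [ChartedSpace E M] [IsManifold 𝓘(ℝ, E) ∞ M]
  {h : P → M} {p : P}

lemma contMDiffAt_trivial_iff {f : P → ℝ} (hh : ContMDiffAt I' 𝓘(ℝ, E) ∞ h p) :
    ContMDiffAt I' (𝓘(ℝ, E).prod 𝓘(ℝ, ℝ)) ∞
      (fun q ↦ TotalSpace.mk' ℝ (E := Bundle.Trivial M ℝ) (h q) (f q)) p ↔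
    ContMDiffAt I' 𝓘(ℝ, ℝ) ∞ f p := by
  rw [contMDiffAt_totalSpace]
  exact ⟨fun H ↦ H.2, fun H ↦ ⟨hh, H⟩⟩

lemma contMDiffAt_bilin_apply
    {β : ∀ q, TangentSpace 𝓘(ℝ, E) (h q) →L[ℝ] TangentSpace 𝓘(ℝ, E) (h q) →L[ℝ] ℝ}
    {v w : ∀ q, TangentSpace 𝓘(ℝ, E) (h q)}
    (hβ : ContMDiffAt I' (𝓘(ℝ, E).prod 𝓘(ℝ, E →L[ℝ] E →L[ℝ] ℝ)) ∞
      (fun q ↦ (TotalSpace.mk' (E →L[ℝ] E →L[ℝ] ℝ) (h q) (β q) :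
        TotalSpace (E →L[ℝ] E →L[ℝ] ℝ)
          (fun x : M ↦ TangentSpace 𝓘(ℝ, E) x →L[ℝ] TangentSpace 𝓘(ℝ, E) x →L[ℝ] ℝ))) p)
    (hv : ContMDiffAt I' 𝓘(ℝ, E).tangent ∞ (fun q ↦ TotalSpace.mk' E (h q) (v q)) p)
    (hw : ContMDiffAt I' 𝓘(ℝ, E).tangent ∞ (fun q ↦ TotalSpace.mk' E (h q) (w q)) p) :
    ContMDiffAt I' 𝓘(ℝ, ℝ) ∞ (fun q ↦ β q (v q) (w q)) p :=
  (contMDiffAt_trivial_iff (contMDiffAt_totalSpace.1 hv).1).1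
    (ContMDiffAt.clm_bundle_apply₂ (F₁ := E) (F₂ := E) hβ hv hw)

lemma contMDiffAt_covector_of_apply [FiniteDimensional ℝ E]
    {φ : ∀ q, TangentSpace 𝓘(ℝ, E) (h q) →L[ℝ] ℝ} (hh : ContMDiffAt I' 𝓘(ℝ, E) ∞ h p)
    (hφ : ∀ v : ∀ q, TangentSpace 𝓘(ℝ, E) (h q),
      ContMDiffAt I' 𝓘(ℝ, E).tangent ∞ (fun q ↦ TotalSpace.mk' E (h q) (v q)) p →
      ContMDiffAt I' 𝓘(ℝ, ℝ) ∞ (fun q ↦ φ q (v q)) p) :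
    ContMDiffAt I' (𝓘(ℝ, E).prod 𝓘(ℝ, E →L[ℝ] ℝ)) ∞
      (fun q ↦ (TotalSpace.mk' (E →L[ℝ] ℝ) (h q) (φ q) :
        TotalSpace (E →L[ℝ] ℝ) (fun x : M ↦ TangentSpace 𝓘(ℝ, E) x →L[ℝ] ℝ))) p :=
  contMDiffAt_hom_of_apply (F₁ := E) (F₂ := ℝ) (V₂ := Bundle.Trivial M ℝ) hh
    fun v hv ↦ (contMDiffAt_trivial_iff hh).2 (hφ v hv)

lemma contMDiffAt_bilin_of_apply [FiniteDimensional ℝ E]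
    {β : ∀ q, TangentSpace 𝓘(ℝ, E) (h q) →L[ℝ] TangentSpace 𝓘(ℝ, E) (h q) →L[ℝ] ℝ}
    (hh : ContMDiffAt I' 𝓘(ℝ, E) ∞ h p)
    (hβ : ∀ v w : ∀ q, TangentSpace 𝓘(ℝ, E) (h q),
      ContMDiffAt I' 𝓘(ℝ, E).tangent ∞ (fun q ↦ TotalSpace.mk' E (h q) (v q)) p →
      ContMDiffAt I' 𝓘(ℝ, E).tangent ∞ (fun q ↦ TotalSpace.mk' E (h q) (w q)) p →
      ContMDiffAt I' 𝓘(ℝ, ℝ) ∞ (fun q ↦ β q (v q) (w q)) p) :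
    ContMDiffAt I' (𝓘(ℝ, E).prod 𝓘(ℝ, E →L[ℝ] E →L[ℝ] ℝ)) ∞
      (fun q ↦ (TotalSpace.mk' (E →L[ℝ] E →L[ℝ] ℝ) (h q) (β q) :
        TotalSpace (E →L[ℝ] E →L[ℝ] ℝ)
          (fun x : M ↦ TangentSpace 𝓘(ℝ, E) x →L[ℝ] TangentSpace 𝓘(ℝ, E) x →L[ℝ] ℝ))) p :=
  contMDiffAt_hom_of_apply (F₁ := E) (F₂ := E →L[ℝ] ℝ)
    (V₂ := fun x : M ↦ TangentSpace 𝓘(ℝ, E) x →L[ℝ] ℝ) hh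
    fun v hv ↦ contMDiffAt_covector_of_apply hh fun w hw ↦ hβ v w hv hw

lemma contMDiffAt_mfderiv_apply {F : Type*} [NormedAddCommGroup F] [NormedSpace ℝ F]
    {N : Type*} [TopologicalSpace N] [ChartedSpace F N] [IsManifold 𝓘(ℝ, F) ∞ N]
    {f : M → N} {v : ∀ q, TangentSpace 𝓘(ℝ, E) (h q)}
    (hf : ContMDiffAt 𝓘(ℝ, E) 𝓘(ℝ, F) ∞ f (h p))
    (hv : ContMDiffAt I' 𝓘(ℝ, E).tangent ∞ (fun q ↦ TotalSpace.mk' E (h q) (v q)) p) :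
    ContMDiffAt I' 𝓘(ℝ, F).tangent ∞
      (fun q ↦ TotalSpace.mk' F (f (h q)) (mfderiv 𝓘(ℝ, E) 𝓘(ℝ, F) f (h q) (v q))) p := by
  have hh : ContMDiffAt I' 𝓘(ℝ, E) ∞ h p := (contMDiffAt_totalSpace.1 hv).1
  refine ContMDiffAt.clm_apply_of_inCoordinates (F₁ := E) (F₂ := F)
    (E₂ := fun y : N ↦ TangentSpace 𝓘(ℝ, F) y) ?_ hv (hf.comp p hh)
  exact (hf.mfderiv_const (m := ∞) (by simp)).comp p hh

/-- A smooth curve in a fiber of the tangent bundle is differentiable. -/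
lemma differentiableAt_of_contMDiffAt_mk {x : M} {c : ℝ → TangentSpace 𝓘(ℝ, E) x} {t : ℝ}
    (hc : ContMDiffAt 𝓘(ℝ, ℝ) 𝓘(ℝ, E).tangent ∞ (fun s ↦ TotalSpace.mk' E x (c s)) t) :
    ∃ D : TangentSpace 𝓘(ℝ, E) x, HasDerivAt c D t := by
  set e := (trivializationAt E (TangentSpace 𝓘(ℝ, E)) x).continuousLinearEquivAt ℝ x
    (FiberBundle.mem_baseSet_trivializationAt' x)
  have h1 : DifferentiableAt ℝ (fun s ↦ e (c s)) t :=
    (contMDiffAt_totalSpace.1 hc).2.contDiffAt.differentiableAt (by simp)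
  let e' : E →L[ℝ] E := (e.symm : E →L[ℝ] TangentSpace 𝓘(ℝ, E) x)
  have h2 : HasDerivAt (F := E) (fun s ↦ e' (e (c s))) _ t :=
    e'.hasFDerivAt.comp_hasDerivAt t h1.hasDerivAt
  have h3 : (fun s ↦ e' (e (c s))) = c := funext fun s ↦ e.symm_apply_apply (c s)
  rw [h3] at h2
  exact ⟨_, h2⟩

end TangentSections


section Lifts

variable {E : Type*} [NormedAddCommGroup E] [NormedSpace ℝ E] [FiniteDimensional ℝ E]
  {M : Type*} [TopologicalSpace M] [ChartedSpace E M] [IsManifold 𝓘(ℝ, E) ∞ M]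
  {F : Type*} [NormedAddCommGroup F] [NormedSpace ℝ F]
  {N : Type*} [TopologicalSpace N] [ChartedSpace F N]
  {g : Metric E M} {pr : M → N} {x : M}

lemma mem_vert {v : TangentSpace 𝓘(ℝ, E) x} :
    v ∈ vert E F pr x ↔ mfderiv 𝓘(ℝ, E) 𝓘(ℝ, F) pr x v = 0 := Iff.rfl

lemma mem_horiz {v : TangentSpace 𝓘(ℝ, E) x} :
    v ∈ horiz F g pr x ↔ ∀ u ∈ vert E F pr x, g.inner x u v = 0 := Iff.rfl

lemma horizProj_mem (v : TangentSpace 𝓘(ℝ, E) x) : horizProj F g pr x v ∈ horiz F g pr x :=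
  Submodule.projection_apply_mem _ _

lemma horizProj_eq_self {v : TangentSpace 𝓘(ℝ, E) x} (hv : v ∈ horiz F g pr x) :
    horizProj F g pr x v = v :=
  Submodule.projection_apply_left _ ⟨v, hv⟩

lemma horizProj_eq_zero {v : TangentSpace 𝓘(ℝ, E) x} (hv : v ∈ vert E F pr x) :
    horizProj F g pr x v = 0 :=
  (Submodule.projection_apply_eq_zero_iff _).2 hv

lemma sub_horizProj_mem (v : TangentSpace 𝓘(ℝ, E) x) :
    v - horizProj F g pr x v ∈ vert E F pr x := by
  have : horizProj F g pr x (v - horizProj F g pr x v) = 0 := by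
    rw [map_sub, horizProj_eq_self (horizProj_mem v), sub_self]
  exact (Submodule.projection_apply_eq_zero_iff _).1 this

lemma mfderiv_horizProj (v : TangentSpace 𝓘(ℝ, E) x) :
    mfderiv 𝓘(ℝ, E) 𝓘(ℝ, F) pr x (horizProj F g pr x v) = mfderiv 𝓘(ℝ, E) 𝓘(ℝ, F) pr x v := by
  have := mem_vert.1 (sub_horizProj_mem (F := F) (g := g) (pr := pr) v)
  rw [map_sub, sub_eq_zero] at this
  exact this.symm

/-- Horizontal vectors are determined by their images in the base. -/
lemma eq_of_mem_horiz {v w : TangentSpace 𝓘(ℝ, E) x} (hv : v ∈ horiz F g pr x)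
    (hw : w ∈ horiz F g pr x)
    (h : mfderiv 𝓘(ℝ, E) 𝓘(ℝ, F) pr x v = mfderiv 𝓘(ℝ, E) 𝓘(ℝ, F) pr x w) : v = w := by
  have h1 : v - w ∈ vert E F pr x := by rw [mem_vert, map_sub, h, sub_self]
  rw [← sub_eq_zero, ← horizProj_eq_self (sub_mem hv hw), horizProj_eq_zero h1]

variable (F) in
/-- The horizontal lift of a tangent vector of the base. -/
def liftVec (g : Metric E M) (pr : M → N) (x : M) (w : TangentSpace 𝓘(ℝ, F) (pr x)) :
    TangentSpace 𝓘(ℝ, E) x :=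
  horizProj F g pr x (Function.invFun (mfderiv 𝓘(ℝ, E) 𝓘(ℝ, F) pr x) w)

lemma horizLift_apply (W : VField F N) : horizLift g pr W x = liftVec F g pr x (W (pr x)) := rfl

lemma liftVec_mem (w : TangentSpace 𝓘(ℝ, F) (pr x)) : liftVec F g pr x w ∈ horiz F g pr x :=
  horizProj_mem _

variable [IsManifold 𝓘(ℝ, F) ∞ N] {gN : Metric F N}

lemma IsRiemannianSubmersion.mfderiv_liftVec (hg : IsRiemannianSubmersion g gN pr)
    (w : TangentSpace 𝓘(ℝ, F) (pr x)) :
    mfderiv 𝓘(ℝ, E) 𝓘(ℝ, F) pr x (liftVec F g pr x w) = w := by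
  rw [liftVec, mfderiv_horizProj]
  exact Function.invFun_eq (hg.surjective x w)

lemma IsRiemannianSubmersion.eq_liftVec (hg : IsRiemannianSubmersion g gN pr)
    {v : TangentSpace 𝓘(ℝ, E) x} (hv : v ∈ horiz F g pr x) :
    v = liftVec F g pr x (mfderiv 𝓘(ℝ, E) 𝓘(ℝ, F) pr x v) :=
  eq_of_mem_horiz hv (liftVec_mem _) (hg.mfderiv_liftVec _).symm

lemma IsRiemannianSubmersion.inner_liftVec (hg : IsRiemannianSubmersion g gN pr)
    (w : TangentSpace 𝓘(ℝ, F) (pr x)) (v : TangentSpace 𝓘(ℝ, E) x) :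
    g.inner x (liftVec F g pr x w) v = gN.inner (pr x) w (mfderiv 𝓘(ℝ, E) 𝓘(ℝ, F) pr x v) := by
  have h1 : g.inner x (liftVec F g pr x w) (v - horizProj F g pr x v) = 0 := by
    rw [g.symm]
    exact mem_horiz.1 (liftVec_mem w) _ (sub_horizProj_mem v)
  rw [map_sub, sub_eq_zero] at h1
  rw [h1, hg.isometry x _ (liftVec_mem w) _ (horizProj_mem v), hg.mfderiv_liftVec,
    mfderiv_horizProj]

lemma IsRiemannianSubmersion.inner_liftVec_liftVec (hg : IsRiemannianSubmersion g gN pr)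
    (w w' : TangentSpace 𝓘(ℝ, F) (pr x)) :
    g.inner x (liftVec F g pr x w) (liftVec F g pr x w') = gN.inner (pr x) w w' := by
  rw [hg.inner_liftVec, hg.mfderiv_liftVec]

lemma IsRiemannianSubmersion.horizProj_eq_liftVec (hg : IsRiemannianSubmersion g gN pr)
    (v : TangentSpace 𝓘(ℝ, E) x) :
    horizProj F g pr x v = liftVec F g pr x (mfderiv 𝓘(ℝ, E) 𝓘(ℝ, F) pr x v) := by
  rw [hg.eq_liftVec (horizProj_mem v), mfderiv_horizProj]

lemma IsRiemannianSubmersion.liftVec_smul (hg : IsRiemannianSubmersion g gN pr) (c : ℝ)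
    (w : TangentSpace 𝓘(ℝ, F) (pr x)) :
    liftVec F g pr x (c • w) = c • liftVec F g pr x w := by
  refine eq_of_mem_horiz (liftVec_mem _) (Submodule.smul_mem _ _ (liftVec_mem _)) ?_
  simp [hg.mfderiv_liftVec]

lemma IsRiemannianSubmersion.liftVec_sum (hg : IsRiemannianSubmersion g gN pr) {ι : Type*}
    (s : Finset ι) (w : ι → TangentSpace 𝓘(ℝ, F) (pr x)) :
    liftVec F g pr x (∑ i ∈ s, w i) = ∑ i ∈ s, liftVec F g pr x (w i) := by
  refine eq_of_mem_horiz (liftVec_mem _) (sum_mem fun _ _ ↦ liftVec_mem _) ?_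
  simp [hg.mfderiv_liftVec]

lemma inner_bijective (g : Metric E M) (x : M) : Function.Bijective (g.inner x) := by
  refine ⟨fun v w hvw ↦ g.ext_inner fun u ↦ by rw [hvw], fun φ ↦ ⟨sharp g x φ, ?_⟩⟩
  ext u
  exact inner_sharp g x _ u

/-- Horizontal lifts depend smoothly on parameters. -/
lemma contMDiffAt_horizLift [FiniteDimensional ℝ F]
    {E' : Type*} [NormedAddCommGroup E'] [NormedSpace ℝ E']
    {H' : Type*} [TopologicalSpace H'] {I' : ModelWithCorners ℝ E' H'}
    {P : Type*} [TopologicalSpace P] [ChartedSpace H' P] {h : P → M} {p : P}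
    {G : P → Metric E M}
    (hG : ContMDiffAt I' (𝓘(ℝ, E).prod 𝓘(ℝ, E →L[ℝ] E →L[ℝ] ℝ)) ∞
      (fun q ↦ (TotalSpace.mk' (E →L[ℝ] E →L[ℝ] ℝ) (h q) ((G q).inner (h q)) :
        TotalSpace (E →L[ℝ] E →L[ℝ] ℝ)
          (fun y : M ↦ TangentSpace 𝓘(ℝ, E) y →L[ℝ] TangentSpace 𝓘(ℝ, E) y →L[ℝ] ℝ))) p)
    (hsub : ∀ᶠ q in 𝓝 p, IsRiemannianSubmersion (G q) gN pr) {W : VField F N}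
    (hW : ContMDiffAt 𝓘(ℝ, F) 𝓘(ℝ, F).tangent ∞ (fun y ↦ (W y : TangentBundle 𝓘(ℝ, F) N))
      (pr (h p))) :
    ContMDiffAt I' 𝓘(ℝ, E).tangent ∞ (fun q ↦ TotalSpace.mk' E (h q) (horizLift (G q) pr W (h q)))
      p := by
  have hh : ContMDiffAt I' 𝓘(ℝ, E) ∞ h p := (contMDiffAt_hom_bundle _).1 hG |>.1
  have hpr : ContMDiffAt 𝓘(ℝ, E) 𝓘(ℝ, F) ∞ pr (h p) := hsub.self_of_nhds.smooth _
  refine contMDiffAt_of_clm_apply (F₁ := E) (F₂ := E →L[ℝ] ℝ)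
    (V₂ := fun x : M ↦ TangentSpace 𝓘(ℝ, E) x →L[ℝ] ℝ) hG
    (.of_forall fun q ↦ inner_bijective (G q) (h q)) ?_
  refine contMDiffAt_covector_of_apply hh fun v hv ↦ ?_
  have h1 : ContMDiffAt I' 𝓘(ℝ, ℝ) ∞ (fun q ↦ gN.inner (pr (h q)) (W (pr (h q)))
      (mfderiv 𝓘(ℝ, E) 𝓘(ℝ, F) pr (h q) (v q))) p := by
    refine contMDiffAt_bilin_apply (h := fun q ↦ pr (h q)) ?_ ?_ (contMDiffAt_mfderiv_apply hpr hv)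
    · exact (gN.contMDiff.contMDiffAt).comp p (hpr.comp p hh)
    · exact hW.comp p (hpr.comp p hh)
  refine h1.congr_of_eventuallyEq ?_
  filter_upwards [hsub] with q hq
  rw [horizLift_apply, hq.inner_liftVec]

lemma IsRiemannianSubmersion.smoothOn_horizLift [FiniteDimensional ℝ F]
    (hg : IsRiemannianSubmersion g gN pr) {W : VField F N} {U : Set N} (hU : IsOpen U)
    (hW : SmoothOn W U) : SmoothOn (horizLift g pr W) (pr ⁻¹' U) := fun x hx ↦
  (contMDiffAt_horizLift (h := fun y : M ↦ y) (G := fun _ ↦ g) g.contMDiff.contMDiffAt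
    (.of_forall fun _ ↦ hg) ((hW _ hx).contMDiffAt (hU.mem_nhds hx))).contMDiffWithinAt

end Lifts

section LieBrackets

lemma natCast_le_infty (n : ℕ) : (n : WithTop ℕ∞) ≤ ∞ := by exact_mod_cast le_top

variable {E : Type*} [NormedAddCommGroup E] [NormedSpace ℝ E] [FiniteDimensional ℝ E]
  {M : Type*} [TopologicalSpace M] [ChartedSpace E M] [IsManifold 𝓘(ℝ, E) ∞ M]
  {X Y Z : VField E M} {s : Set M} {x : M} {u : M → ℝ}

lemma SmoothOn.contMDiffAt (hX : SmoothOn X s) (hs : IsOpen s) (hx : x ∈ s) :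
    ContMDiffAt 𝓘(ℝ, E) 𝓘(ℝ, E).tangent ∞ (T% X) x :=
  ContMDiffWithinAt.contMDiffAt (hX x hx) (hs.mem_nhds hx)

lemma SmoothOn.mdiffAt (hX : SmoothOn X s) (hs : IsOpen s) (hx : x ∈ s) : MDiffAt (T% X) x :=
  (hX.contMDiffAt hs hx).mdifferentiableAt (by simp)

lemma contMDiffAt_mvfderiv_apply (hu : ContMDiffAt 𝓘(ℝ, E) 𝓘(ℝ, ℝ) ∞ u x)
    (hX : ContMDiffAt 𝓘(ℝ, E) 𝓘(ℝ, E).tangent ∞ (T% X) x) :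
    ContMDiffAt 𝓘(ℝ, E) 𝓘(ℝ, ℝ) ∞ (fun y ↦ mvfderiv 𝓘(ℝ, E) u y (X y)) x := by
  have := (contMDiffAt_totalSpace.1 (contMDiffAt_mfderiv_apply (h := fun y : M ↦ y) hu hX)).2
  simpa [mvfderiv] using! this

lemma SmoothOn.mlieBracket (hX : SmoothOn X s) (hY : SmoothOn Y s) (hs : IsOpen s) :
    SmoothOn (mlieBracket 𝓘(ℝ, E) X Y) s := by
  have : IsManifold 𝓘(ℝ, E) (minSmoothness ℝ 2) M :=
    IsManifold.of_le (n := ∞) (by simpa using natCast_le_infty 2)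
  have : IsManifold 𝓘(ℝ, E) (((⊤ : ℕ∞) : WithTop ℕ∞) + 1) M :=
    IsManifold.of_le (n := ∞) (by simp)
  exact fun y hy ↦
    ContMDiffAt.contMDiffWithinAt <| ContMDiffAt.mlieBracket_vectorField (n := ⊤) (m := ⊤)
      (hX.contMDiffAt hs hy) (hY.contMDiffAt hs hy) (by simp)

lemma SmoothOn.add (hX : SmoothOn X s) (hY : SmoothOn Y s) : SmoothOn (X + Y) s :=
  ContMDiffOn.add_section hX hY

lemma SmoothOn.smul (hu : ContMDiffOn 𝓘(ℝ, E) 𝓘(ℝ, ℝ) ∞ u s) (hX : SmoothOn X s) :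
    SmoothOn (u • X) s :=
  ContMDiffOn.smul_section hu hX

lemma contMDiffOn_mvfderiv_apply (hs : IsOpen s) (hu : ContMDiffOn 𝓘(ℝ, E) 𝓘(ℝ, ℝ) ∞ u s)
    (hX : SmoothOn X s) :
    ContMDiffOn 𝓘(ℝ, E) 𝓘(ℝ, ℝ) ∞ (fun y ↦ mvfderiv 𝓘(ℝ, E) u y (X y)) s := fun y hy ↦
  (contMDiffAt_mvfderiv_apply ((hu y hy).contMDiffAt (hs.mem_nhds hy))
    (hX.contMDiffAt hs hy)).contMDiffWithinAt

/-- The Lie bracket acts on functions as the commutator of the derivations. -/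
lemma mvfderiv_mlieBracket (hs : IsOpen s) (hx : x ∈ s) (hX : SmoothOn X s) (hY : SmoothOn Y s)
    (hu : ContMDiffOn 𝓘(ℝ, E) 𝓘(ℝ, ℝ) ∞ u s) :
    mvfderiv 𝓘(ℝ, E) u x (mlieBracket 𝓘(ℝ, E) X Y x)
      = mvfderiv 𝓘(ℝ, E) (fun y ↦ mvfderiv 𝓘(ℝ, E) u y (Y y)) x (X x)
        - mvfderiv 𝓘(ℝ, E) (fun y ↦ mvfderiv 𝓘(ℝ, E) u y (X y)) x (Y x) := by
  rcases subsingleton_or_nontrivial (TangentSpace 𝓘(ℝ, E) x) with h0 | h0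
  · simp [Subsingleton.elim (X x) 0, Subsingleton.elim (Y x) 0,
      Subsingleton.elim (mlieBracket 𝓘(ℝ, E) X Y x) 0]
  obtain ⟨z, hz⟩ := exists_ne (0 : TangentSpace 𝓘(ℝ, E) x)
  obtain ⟨s', hs', hZ'⟩ := FiberBundle.exists_contMDiffOn_extend (k := ∞) 𝓘(ℝ, E) E z
  obtain ⟨t, hts, ht, hxt⟩ := mem_nhds_iff.1 (Filter.inter_mem hs' (hs.mem_nhds hx))
  set Z : VField E M := FiberBundle.extend E z
  have hZx : Z x = z := FiberBundle.extend_apply_self E z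
  replace hZ' : SmoothOn Z t := hZ'.mono fun y hy ↦ (hts hy).1
  replace hX : SmoothOn X t := hX.mono fun y hy ↦ (hts hy).2
  replace hY : SmoothOn Y t := hY.mono fun y hy ↦ (hts hy).2
  replace hu : ContMDiffOn 𝓘(ℝ, E) 𝓘(ℝ, ℝ) ∞ u t := hu.mono fun y hy ↦ (hts hy).2
  have hud : ∀ {f : M → ℝ}, ContMDiffOn 𝓘(ℝ, E) 𝓘(ℝ, ℝ) ∞ f t → ∀ y ∈ t, MDiffAt f y :=
    fun hf y hy ↦ ((hf y hy).contMDiffAt (ht.mem_nhds hy)).mdifferentiableAt (by simp)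
  have : IsManifold 𝓘(ℝ, E) (minSmoothness ℝ 3) M :=
    IsManifold.of_le (n := ∞) (by simpa using natCast_le_infty 3)
  have h2 : minSmoothness ℝ 2 ≤ ∞ := by simpa using natCast_le_infty 2
  have jac : ∀ Z' : VField E M, SmoothOn Z' t → mlieBracket 𝓘(ℝ, E) X (mlieBracket 𝓘(ℝ, E) Y Z') x
      = mlieBracket 𝓘(ℝ, E) (mlieBracket 𝓘(ℝ, E) X Y) Z' x
        + mlieBracket 𝓘(ℝ, E) Y (mlieBracket 𝓘(ℝ, E) X Z') x := fun Z' hZ ↦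
    leibniz_identity_mlieBracket_apply ((hX.contMDiffAt ht hxt).of_le h2)
      ((hY.contMDiffAt ht hxt).of_le h2) ((hZ.contMDiffAt ht hxt).of_le h2)
  have expand : ∀ X' Y' : VField E M, SmoothOn X' t → SmoothOn Y' t →
      mlieBracket 𝓘(ℝ, E) X' (mlieBracket 𝓘(ℝ, E) Y' (u • Z)) x
        = (mvfderiv 𝓘(ℝ, E) (fun y ↦ mvfderiv 𝓘(ℝ, E) u y (Y' y)) x (X' x) • Z x
          + mvfderiv 𝓘(ℝ, E) u x (Y' x) • mlieBracket 𝓘(ℝ, E) X' Z x)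
          + (mvfderiv 𝓘(ℝ, E) u x (X' x) • mlieBracket 𝓘(ℝ, E) Y' Z x
          + u x • mlieBracket 𝓘(ℝ, E) X' (mlieBracket 𝓘(ℝ, E) Y' Z) x) := by
    intro X' Y' hX' hY'
    have h1 : mlieBracket 𝓘(ℝ, E) Y' (u • Z) =ᶠ[𝓝 x]
        ((fun y ↦ mvfderiv 𝓘(ℝ, E) u y (Y' y)) • Z + u • mlieBracket 𝓘(ℝ, E) Y' Z) := by
      filter_upwards [ht.mem_nhds hxt] with y hy
      exact mlieBracket_smul_right (hud hu y hy) (hZ'.mdiffAt ht hy)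
    have hd := contMDiffOn_mvfderiv_apply ht hu hY'
    have hb := hY'.mlieBracket hZ' ht
    rw [Filter.EventuallyEq.rfl.mlieBracket_vectorField_eq h1,
      mlieBracket_add_right ((SmoothOn.smul hd hZ').mdiffAt ht hxt)
        ((SmoothOn.smul hu hb).mdiffAt ht hxt),
      mlieBracket_smul_right (hud hd x hxt) (hZ'.mdiffAt ht hxt),
      mlieBracket_smul_right (hud hu x hxt) (hb.mdiffAt ht hxt)]
  have key := jac (u • Z) (SmoothOn.smul hu hZ')
  rw [expand X Y hX hY, expand Y X hY hX,
    mlieBracket_smul_right (hud hu x hxt) (hZ'.mdiffAt ht hxt), jac Z hZ', hZx] at key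
  have h2 : (mvfderiv 𝓘(ℝ, E) u x (mlieBracket 𝓘(ℝ, E) X Y x)
      - (mvfderiv 𝓘(ℝ, E) (fun y ↦ mvfderiv 𝓘(ℝ, E) u y (Y y)) x (X x)
        - mvfderiv 𝓘(ℝ, E) (fun y ↦ mvfderiv 𝓘(ℝ, E) u y (X y)) x (Y x))) • z = 0 := by
    rw [← sub_eq_zero] at key
    rw [← neg_eq_zero, ← key]
    module
  exact sub_eq_zero.1 ((smul_eq_zero.1 h2).resolve_right hz)

end LieBrackets

section Verticality

variable {E : Type*} [NormedAddCommGroup E] [NormedSpace ℝ E] [FiniteDimensional ℝ E]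
  {M : Type*} [TopologicalSpace M] [ChartedSpace E M] [IsManifold 𝓘(ℝ, E) ∞ M]
  {F : Type*} [NormedAddCommGroup F] [NormedSpace ℝ F] [FiniteDimensional ℝ F]
  {N : Type*} [TopologicalSpace N] [ChartedSpace F N] [IsManifold 𝓘(ℝ, F) ∞ N]
  {pr : M → N} {X Y Z : VField E M} {s : Set M} {x : M}

lemma mvfderiv_fun_comp_apply {k : N → ℝ} (hk : MDiffAt k (pr x))
    (hpr : MDifferentiableAt 𝓘(ℝ, E) 𝓘(ℝ, F) pr x) (v : TangentSpace 𝓘(ℝ, E) x) :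
    mvfderiv 𝓘(ℝ, E) (fun y ↦ k (pr y)) x v
      = mvfderiv 𝓘(ℝ, F) k (pr x) (mfderiv 𝓘(ℝ, E) 𝓘(ℝ, F) pr x v) := by
  have := mfderiv_comp x hk hpr
  simp only [mvfderiv]
  rw [show (fun y ↦ k (pr y)) = k ∘ pr from rfl, this]
  rfl

lemma mvfderiv_congr_nhds {f k : M → ℝ} (h : f =ᶠ[𝓝 x] k) (v : TangentSpace 𝓘(ℝ, E) x) :
    mvfderiv 𝓘(ℝ, E) f x v = mvfderiv 𝓘(ℝ, E) k x v := by
  simp only [mvfderiv, h.mfderiv_eq]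
  rfl

/-- The Lie bracket of a projectable vector field with a vertical one is vertical. -/
lemma mlieBracket_mem_vert (hpr : ContMDiff 𝓘(ℝ, E) 𝓘(ℝ, F) ∞ pr) (hs : IsOpen s) (hx : x ∈ s)
    (hZ : SmoothOn Z s) (hX : SmoothOn X s) (hXv : IsVerticalOn F pr X s) {W : VField F N}
    (hW : ContMDiffAt 𝓘(ℝ, F) 𝓘(ℝ, F).tangent ∞ (T% W) (pr x))
    (hZW : ∀ y ∈ s, mfderiv 𝓘(ℝ, E) 𝓘(ℝ, F) pr y (Z y) = W (pr y)) :
    mlieBracket 𝓘(ℝ, E) Z X x ∈ vert E F pr x := by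
  set c := extChartAt 𝓘(ℝ, F) (pr x)
  have hc : ∀ z ∈ (chartAt F (pr x)).source, ContMDiffAt 𝓘(ℝ, F) 𝓘(ℝ, F) ∞ c z :=
    fun z hz ↦ contMDiffAt_extChartAt' hz
  have hprd : ∀ y, MDifferentiableAt 𝓘(ℝ, E) 𝓘(ℝ, F) pr y := fun y ↦ (hpr y).mdifferentiableAt
    (by simp)
  set t := s ∩ pr ⁻¹' (chartAt F (pr x)).source
  have ht : IsOpen t := hs.inter ((chartAt F (pr x)).open_source.preimage hpr.continuous)
  have hxt : x ∈ t := ⟨hx, mem_chart_source F (pr x)⟩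
  have key : ∀ φ : F →L[ℝ] ℝ, mvfderiv 𝓘(ℝ, F) (fun z ↦ φ (c z)) (pr x)
      (mfderiv 𝓘(ℝ, E) 𝓘(ℝ, F) pr x (mlieBracket 𝓘(ℝ, E) Z X x)) = 0 := by
    intro φ
    have hk : ∀ z ∈ (chartAt F (pr x)).source,
        ContMDiffAt 𝓘(ℝ, F) 𝓘(ℝ, ℝ) ∞ (fun z ↦ φ (c z)) z := fun z hz ↦
      ContMDiffAt.comp z φ.contDiff.contMDiff.contMDiffAt (hc z hz)
    have hkd : ∀ z ∈ (chartAt F (pr x)).source, MDiffAt (fun z ↦ φ (c z)) z := fun z hz ↦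
      (hk z hz).mdifferentiableAt (by simp)
    have hu : ContMDiffOn 𝓘(ℝ, E) 𝓘(ℝ, ℝ) ∞ (fun y ↦ φ (c (pr y))) t := fun y hy ↦
      (ContMDiffAt.comp y (hk (pr y) hy.2) (hpr y)).contMDiffWithinAt
    have e1 : (fun y ↦ mvfderiv 𝓘(ℝ, E) (fun y ↦ φ (c (pr y))) y (X y)) =ᶠ[𝓝 x] fun _ ↦ 0 := by
      filter_upwards [ht.mem_nhds hxt] with y hy
      rw [mvfderiv_fun_comp_apply (k := fun z ↦ φ (c z)) (hkd _ hy.2) (hprd y),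
        mem_vert.1 (hXv y hy.1), map_zero]
    have e2 : (fun y ↦ mvfderiv 𝓘(ℝ, E) (fun y ↦ φ (c (pr y))) y (Z y)) =ᶠ[𝓝 x]
        fun y ↦ (fun z ↦ mvfderiv 𝓘(ℝ, F) (fun z ↦ φ (c z)) z (W z)) (pr y) := by
      filter_upwards [ht.mem_nhds hxt] with y hy
      rw [mvfderiv_fun_comp_apply (k := fun z ↦ φ (c z)) (hkd _ hy.2) (hprd y), hZW y hy.1]
    have hm : MDiffAt (fun z ↦ mvfderiv 𝓘(ℝ, F) (fun z ↦ φ (c z)) z (W z)) (pr x) :=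
      (contMDiffAt_mvfderiv_apply (hk _ hxt.2) hW).mdifferentiableAt (by simp)
    rw [← mvfderiv_fun_comp_apply (k := fun z ↦ φ (c z)) (hkd _ hxt.2) (hprd x),
      mvfderiv_mlieBracket ht hxt (hZ.mono inter_subset_left) (hX.mono inter_subset_left) hu,
      mvfderiv_congr_nhds e1, mvfderiv_congr_nhds e2, mvfderiv_fun_comp_apply hm (hprd x),
      mem_vert.1 (hXv x hx), mvfderiv_const]
    simp
  have hcd : MDifferentiableAt 𝓘(ℝ, F) 𝓘(ℝ, F) c (pr x) :=
    (hc _ hxt.2).mdifferentiableAt (by simp)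
  have hinj := (isInvertible_mfderiv_extChartAt (I := 𝓘(ℝ, F))
    (mem_extChartAt_source (I := 𝓘(ℝ, F)) (pr x))).injective
  rw [mem_vert]
  apply hinj
  rw [map_zero]
  refine (SeparatingDual.eq_zero_iff_forall_dual_eq_zero (R := ℝ) (V := F) _).2 fun φ ↦ ?_
  have := key φ
  rw [mvfderiv_fun_comp_apply (k := φ) φ.mdifferentiableAt hcd] at this
  simpa [mvfderiv, mfderiv_eq_fderiv] using! this

lemma mlieBracket_mem_vert_of_vert (hpr : ContMDiff 𝓘(ℝ, E) 𝓘(ℝ, F) ∞ pr) (hs : IsOpen s)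
    (hx : x ∈ s) (hZ : SmoothOn Z s) (hZv : IsVerticalOn F pr Z s) (hX : SmoothOn X s)
    (hXv : IsVerticalOn F pr X s) : mlieBracket 𝓘(ℝ, E) Z X x ∈ vert E F pr x :=
  mlieBracket_mem_vert (W := 0) hpr hs hx hZ hX hXv (contMDiff_zeroSection _ _).contMDiffAt
    fun y hy ↦ mem_vert.1 (hZv y hy)

end Verticality

section LieDerivative

variable {E : Type*} [NormedAddCommGroup E] [NormedSpace ℝ E] [FiniteDimensional ℝ E]
  {M : Type*} [TopologicalSpace M] [ChartedSpace E M] [IsManifold 𝓘(ℝ, E) ∞ M]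
  {g g' : Metric E M} {X Y Z Z' : VField E M} {s : Set M} {x : M}

lemma lieDerivMetric_add (hZ : MDiffAt (T% Z) x) (hZ' : MDiffAt (T% Z') x) :
    lieDerivMetric g (Z + Z') X Y x = lieDerivMetric g Z X Y x + lieDerivMetric g Z' X Y x := by
  simp only [lieDerivMetric, mlieBracket_add_left hZ hZ', Pi.add_apply, map_add,
    add_apply]
  ring

lemma lieDerivMetric_smul {c : M → ℝ} (hc : MDiffAt c x) (hZ : MDiffAt (T% Z) x) :
    lieDerivMetric g (c • Z) X Y x = c x * lieDerivMetric g Z X Y x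
      + mvfderiv 𝓘(ℝ, E) c x (X x) * g.inner x (Z x) (Y x)
      + mvfderiv 𝓘(ℝ, E) c x (Y x) * g.inner x (X x) (Z x) := by
  simp only [lieDerivMetric, mlieBracket_smul_left hc hZ, Pi.smul_apply', map_add, map_smul,
    map_neg, add_apply, smul_apply,
    neg_apply, neg_smul, smul_eq_mul]
  ring

lemma dInner_congr {X' Y' : VField E M}
    (h : ∀ᶠ y in 𝓝 x, g.inner y (X y) (Y y) = g'.inner y (X' y) (Y' y)) :
    dInner g X Y x = dInner g' X' Y' x := by
  ext v
  exact mvfderiv_congr_nhds (h : (fun y ↦ g.inner y (X y) (Y y)) =ᶠ[𝓝 x] _) v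

/-- `(L_Z g)(X, Y) = X g(Z, Y) + Y g(Z, X) - g(Z, ∇_X Y + ∇_Y X)`. -/
lemma lieDerivMetric_eq_leviCivita (hX : MDiffAt (T% X) x) (hY : MDiffAt (T% Y) x)
    (hZ : MDiffAt (T% Z) x) :
    lieDerivMetric g Z X Y x = dInner g Z Y x (X x) + dInner g Z X x (Y x)
      - g.inner x (Z x) (leviCivita g Y x (X x) + leviCivita g X x (Y x)) := by
  rw [lieDerivMetric, leviCivita_metric g hZ hX hY, leviCivita_metric g hX hZ hY,
    leviCivita_metric g hY hZ hX, ← leviCivita_torsion g hZ hX, ← leviCivita_torsion g hZ hY,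
    g.symm x (leviCivita g Z x (Y x)) (X x)]
  simp only [map_add, map_sub, sub_apply]
  ring

variable {F : Type*} [NormedAddCommGroup F] [NormedSpace ℝ F] [FiniteDimensional ℝ F]
  {N : Type*} [TopologicalSpace N] [ChartedSpace F N] [IsManifold 𝓘(ℝ, F) ∞ N]
  {pr : M → N} {gN : Metric F N}

/-- The Lie derivative of the metric of the fibers along a projectable vector field depends only
on the vertical part of the metric. -/
lemma lieDerivMetric_eq_of_eq_on_vert (hs : IsOpen s) (hx : x ∈ s)
    (hgg' : ∀ y ∈ s, ∀ v ∈ vert E F pr y, ∀ w ∈ vert E F pr y, g.inner y v w = g'.inner y v w)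
    (hX : IsVerticalOn F pr X s) (hY : IsVerticalOn F pr Y s)
    (hZX : mlieBracket 𝓘(ℝ, E) Z X x ∈ vert E F pr x)
    (hZY : mlieBracket 𝓘(ℝ, E) Z Y x ∈ vert E F pr x) :
    lieDerivMetric g Z X Y x = lieDerivMetric g' Z X Y x := by
  rw [lieDerivMetric, lieDerivMetric, hgg' x hx _ hZX _ (hY x hx), hgg' x hx _ (hX x hx) _ hZY,
    dInner_congr (g := g) (g' := g') (X' := X) (Y' := Y)]
  filter_upwards [hs.mem_nhds hx] with y hy
  exact hgg' y hy _ (hX y hy) _ (hY y hy)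

lemma lieDerivMetric_smul_of_vert {c : N → ℝ}
    (hpr : MDifferentiableAt 𝓘(ℝ, E) 𝓘(ℝ, F) pr x) (hc : MDiffAt c (pr x))
    (hZ : MDiffAt (T% Z) x) (hX : X x ∈ vert E F pr x) (hY : Y x ∈ vert E F pr x) :
    lieDerivMetric g ((fun y ↦ c (pr y)) • Z) X Y x = c (pr x) * lieDerivMetric g Z X Y x := by
  have hc' : MDiffAt (fun y ↦ c (pr y)) x := hc.comp x hpr
  rw [lieDerivMetric_smul hc' hZ, mvfderiv_fun_comp_apply hc hpr,
    mvfderiv_fun_comp_apply hc hpr, mem_vert.1 hX, mem_vert.1 hY]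
  simp

/-- The second fundamental form of the fibers is minus half the Lie derivative of the metric along
horizontal fields. -/
lemma inner_secondFF (hpr : ContMDiff 𝓘(ℝ, E) 𝓘(ℝ, F) ∞ pr)
    (hs : IsOpen s) (hx : x ∈ s)
    (hXs : SmoothOn X s) (hX : IsVerticalOn F pr X s)
    (hYs : SmoothOn Y s) (hY : IsVerticalOn F pr Y s)
    (hZs : SmoothOn Z s) (hZ : ∀ y ∈ s, Z y ∈ horiz F g pr y) :
    g.inner x (secondFF F g pr X Y x) (Z x) = -(1 / 2) * lieDerivMetric g Z X Y x := by
  have h1 : g.inner x (secondFF F g pr X Y x) (Z x)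
      = g.inner x (leviCivita g Y x (X x)) (Z x) := by
    have := mem_horiz.1 (hZ x hx) _ (sub_horizProj_mem (g := g) (leviCivita g Y x (X x)))
    rw [map_sub, sub_apply, sub_eq_zero] at this
    exact this.symm
  have h0 : ∀ X' : VField E M, IsVerticalOn F pr X' s → dInner g X' Z x = 0 := by
    intro X' hX'
    rw [dInner_congr (g' := g) (X' := 0) (Y' := 0)]
    · ext v
      simp [dInner, mvfderiv_const]
    · filter_upwards [hs.mem_nhds hx] with y hy
      simpa using mem_horiz.1 (hZ y hy) _ (hX' y hy)
  have hXY := mem_horiz.1 (hZ x hx) _ (mlieBracket_mem_vert_of_vert hpr hs hx hXs hX hYs hY)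
  rw [h1, inner_leviCivita g (hXs.mdiffAt hs hx) (hYs.mdiffAt hs hx) (hZs.mdiffAt hs hx), koszul,
    h0 X hX, h0 Y hY, hXY, lieDerivMetric, g.symm x (X x)]
  simp
  ring

end LieDerivative

section TotallyGeodesic

variable {E : Type*} [NormedAddCommGroup E] [NormedSpace ℝ E] [FiniteDimensional ℝ E]
  {M : Type*} [TopologicalSpace M] [ChartedSpace E M] [IsManifold 𝓘(ℝ, E) ∞ M]
  {F : Type*} [NormedAddCommGroup F] [NormedSpace ℝ F] [FiniteDimensional ℝ F]
  {N : Type*} [TopologicalSpace N] [ChartedSpace F N] [IsManifold 𝓘(ℝ, F) ∞ N]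
  {g g' g₀ : Metric E M} {gN : Metric F N} {pr : M → N} {X Y : VField E M} {x : M}

lemma Metric.ext (h : ∀ x v w, g.inner x v w = g'.inner x v w) : g = g' := by
  have key : g.inner = g'.inner := by
    funext x
    ext v w
    exact h x v w
  cases g
  cases g'
  congr

lemma exists_smooth_eq [T2Space M] (v : TangentSpace 𝓘(ℝ, E) x) :
    ∃ X : VField E M, Smooth X ∧ X x = v := by
  obtain ⟨s, hs, hv⟩ := FiberBundle.exists_contMDiffOn_extend (k := ∞) 𝓘(ℝ, E) E v
  obtain ⟨t, hts, ht, hxt⟩ := mem_nhds_iff.1 hs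
  obtain ⟨f, hf, -⟩ := (SmoothBumpFunction.nhds_basis_support (I := 𝓘(ℝ, E))
    (ht.mem_nhds hxt)).mem_iff.1 (ht.mem_nhds hxt)
  refine ⟨(f : M → ℝ) • FiberBundle.extend E v, contMDiffOn_univ.2
    (ContMDiffOn.smul_section_of_tsupport f.contMDiff.contMDiffOn ht hf (hv.mono hts)), ?_⟩
  simp [Pi.smul_apply']

lemma IsRiemannianSubmersion.smooth_horizLift (hg : IsRiemannianSubmersion g gN pr)
    {W : VField F N} (hW : Smooth W) : Smooth (horizLift g pr W) :=
  hg.smoothOn_horizLift isOpen_univ hW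

lemma IsRiemannianSubmersion.mlieBracket_horizLift_mem (hg : IsRiemannianSubmersion g gN pr)
    {s : Set N} (hs : IsOpen s) (hx : x ∈ pr ⁻¹' s) {W : VField F N} (hW : SmoothOn W s)
    (hXs : SmoothOn X (pr ⁻¹' s)) (hX : IsVerticalOn F pr X (pr ⁻¹' s)) :
    mlieBracket 𝓘(ℝ, E) (horizLift g pr W) X x ∈ vert E F pr x :=
  mlieBracket_mem_vert hg.smooth (hs.preimage hg.smooth.continuous) hx
    (hg.smoothOn_horizLift hs hW) hXs hX (hW.contMDiffAt hs hx) fun _ _ ↦ hg.mfderiv_liftVec _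

/-- The second fundamental form of the fibers for a metric with prescribed vertical part. -/
lemma IsRiemannianSubmersion.inner_secondFF_horizLift (hg : IsRiemannianSubmersion g gN pr)
    {s : Set N} (hs : IsOpen s) (hx : x ∈ pr ⁻¹' s)
    (hgg₀ : ∀ y, ∀ v ∈ vert E F pr y, ∀ w ∈ vert E F pr y, g.inner y v w = g₀.inner y v w)
    {W : VField F N} (hW : SmoothOn W s)
    (hXs : SmoothOn X (pr ⁻¹' s)) (hX : IsVerticalOn F pr X (pr ⁻¹' s))
    (hYs : SmoothOn Y (pr ⁻¹' s)) (hY : IsVerticalOn F pr Y (pr ⁻¹' s)) :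
    g.inner x (secondFF F g pr X Y x) (horizLift g pr W x)
      = -(1 / 2) * lieDerivMetric g₀ (horizLift g pr W) X Y x := by
  have ho := hs.preimage hg.smooth.continuous
  rw [inner_secondFF hg.smooth ho hx hXs hX hYs hY (hg.smoothOn_horizLift hs hW)
    fun y _ ↦ liftVec_mem _, lieDerivMetric_eq_of_eq_on_vert ho hx (fun y _ ↦ hgg₀ y) hX hY
    (hg.mlieBracket_horizLift_mem hs hx hW hXs hX) (hg.mlieBracket_horizLift_mem hs hx hW hYs hY)]

/-- The fibers are totally geodesic if and only if the flows of horizontal lifts are isometries of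
the fibers. -/
lemma IsRiemannianSubmersion.totallyGeodesicFibers_iff [T2Space N]
    (hg : IsRiemannianSubmersion g gN pr)
    (hgg₀ : ∀ y, ∀ v ∈ vert E F pr y, ∀ w ∈ vert E F pr y, g.inner y v w = g₀.inner y v w) :
    TotallyGeodesicFibers F g pr ↔ ∀ W : VField F N, Smooth W → ∀ X Y : VField E M,
      IsVerticalField F pr X → IsVerticalField F pr Y → ∀ x,
      lieDerivMetric g₀ (horizLift g pr W) X Y x = 0 := by
  constructor
  · intro h W hW X Y hX hY x
    have := hg.inner_secondFF_horizLift (x := x) isOpen_univ (mem_univ (pr x)) hgg₀ hW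
      hX.1 hX.2 hY.1 hY.2
    rw [h X Y hX hY x] at this
    simpa using this
  · intro h X Y hX hY x
    obtain ⟨W, hW, hWx⟩ := exists_smooth_eq
      (mfderiv 𝓘(ℝ, E) 𝓘(ℝ, F) pr x (secondFF F g pr X Y x))
    have := hg.inner_secondFF_horizLift (x := x) isOpen_univ (mem_univ (pr x)) hgg₀ hW
      hX.1 hX.2 hY.1 hY.2
    rw [h W hW X Y hX hY x, horizLift_apply, hWx,
      ← hg.eq_liftVec (v := secondFF F g pr X Y x) (horizProj_mem _)] at this
    by_contra hne
    exact (g.pos x _ hne).ne' (by simpa using this)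

/-- Metrics with the same vertical part and the same horizontal lifts agree. -/
lemma IsRiemannianSubmersion.eq_of_liftVec_eq (hg : IsRiemannianSubmersion g gN pr)
    (hg' : IsRiemannianSubmersion g' gN pr)
    (hgg' : ∀ y, ∀ v ∈ vert E F pr y, ∀ w ∈ vert E F pr y, g.inner y v w = g'.inner y v w)
    (h : ∀ x w, liftVec F g pr x w = liftVec F g' pr x w) : g = g' := by
  refine Metric.ext fun x v w ↦ ?_
  have hP : ∀ u, horizProj F g pr x u = horizProj F g' pr x u := fun u ↦ by
    rw [hg.horizProj_eq_liftVec, hg'.horizProj_eq_liftVec, h]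
  have hsplit : ∀ {k : Metric E M}, IsRiemannianSubmersion k gN pr →
      k.inner x v w = gN.inner (pr x) (mfderiv 𝓘(ℝ, E) 𝓘(ℝ, F) pr x v)
          (mfderiv 𝓘(ℝ, E) 𝓘(ℝ, F) pr x w)
        + k.inner x (v - horizProj F k pr x v) (w - horizProj F k pr x w) := by
    intro k hk
    have h1 := hk.isometry x _ (horizProj_mem v) _ (horizProj_mem w)
    have h2 := mem_horiz.1 (horizProj_mem (g := k) w) _
      (sub_horizProj_mem (F := F) (g := k) (pr := pr) v)
    have h3 := mem_horiz.1 (horizProj_mem (F := F) (g := k) (pr := pr) v) _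
      (sub_horizProj_mem (F := F) (g := k) (pr := pr) w)
    rw [mfderiv_horizProj, mfderiv_horizProj] at h1
    rw [k.symm] at h3
    rw [← h1]
    simp only [map_sub, sub_apply] at h2 h3 ⊢
    linarith
  rw [hsplit hg, hsplit hg', hgg' x _ (sub_horizProj_mem v) _ (sub_horizProj_mem w), hP, hP]

/-- The difference of two distinct Riemannian submersion metrics with totally geodesic fibers
yields a vertical field which is a Killing field on the fibers. -/
lemma exists_killing_of_ne [T2Space N] (hg : IsRiemannianSubmersion g gN pr)
    (hg₀ : IsRiemannianSubmersion g₀ gN pr) (hne : g ≠ g₀)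
    (hgg₀ : ∀ y, ∀ v ∈ vert E F pr y, ∀ w ∈ vert E F pr y, g.inner y v w = g₀.inner y v w)
    (hT : TotallyGeodesicFibers F g pr) (hT₀ : TotallyGeodesicFibers F g₀ pr) :
    ∃ ξ : VField E M, IsVerticalField F pr ξ ∧ (∃ x, ξ x ≠ 0) ∧
      ∀ y : N, IsKillingOnFiber F g₀ pr ξ y := by
  have hex : ∃ x w, liftVec F g pr x w ≠ liftVec F g₀ pr x w := by
    by_contra! h
    exact hne (hg.eq_of_liftVec_eq hg₀ hgg₀ h)
  obtain ⟨x, w, hxw⟩ := hex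
  obtain ⟨W, hW, hWx⟩ := exists_smooth_eq w
  have h1 := hg.smooth_horizLift hW
  have h2 := hg₀.smooth_horizLift hW
  have h3 : Smooth ((fun _ : M ↦ (-1 : ℝ)) • horizLift g₀ pr W) :=
    SmoothOn.smul contMDiffOn_const h2
  refine ⟨horizLift g pr W + (fun _ : M ↦ (-1 : ℝ)) • horizLift g₀ pr W,
    ⟨SmoothOn.add h1 h3, fun y _ ↦ ?_⟩, ⟨x, ?_⟩, fun y X Y hX hY z _ ↦ ?_⟩
  · rw [mem_vert]
    simp [horizLift_apply, hg.mfderiv_liftVec, hg₀.mfderiv_liftVec]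
  · simpa [horizLift_apply, hWx, ← sub_eq_add_neg, sub_eq_zero] using hxw
  · have hd1 := SmoothOn.mdiffAt h1 isOpen_univ (mem_univ z)
    have hd2 := SmoothOn.mdiffAt h2 isOpen_univ (mem_univ z)
    have hd3 := SmoothOn.mdiffAt h3 isOpen_univ (mem_univ z)
    rw [lieDerivMetric_add hd1 hd3, lieDerivMetric_smul mdifferentiableAt_const hd2,
      (hg.totallyGeodesicFibers_iff hgg₀).1 hT W hW X Y hX hY,
      (hg₀.totallyGeodesicFibers_iff fun _ _ _ _ _ ↦ rfl).1 hT₀ W hW X Y hX hY, mvfderiv_const]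
    simp

end TotallyGeodesic

section Shear

variable {E : Type*} [NormedAddCommGroup E] [NormedSpace ℝ E] [FiniteDimensional ℝ E]
  {M : Type*} [TopologicalSpace M] [ChartedSpace E M] [IsManifold 𝓘(ℝ, E) ∞ M]
  {g₀ : Metric E M} {η ξ : VField E M} {t : ℝ} {x : M}

/-- The endomorphism `v ↦ v - t g₀(η, v) ξ` of the tangent spaces. -/
def shear (g₀ : Metric E M) (η ξ : VField E M) (t : ℝ) (x : M) :
    TangentSpace 𝓘(ℝ, E) x →L[ℝ] TangentSpace 𝓘(ℝ, E) x :=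
  ContinuousLinearMap.id ℝ _ - t • (g₀.inner x (η x)).smulRight (ξ x)

@[simp] lemma shear_apply (v : TangentSpace 𝓘(ℝ, E) x) :
    shear g₀ η ξ t x v = v - t • g₀.inner x (η x) v • ξ x := rfl

lemma shear_neg_shear (h : g₀.inner x (η x) (ξ x) = 0) (v : TangentSpace 𝓘(ℝ, E) x) :
    shear g₀ η ξ (-t) x (shear g₀ η ξ t x v) = v := by
  simp [h]

/-- The pullback of the metric `g₀` by `shear g₀ η ξ t`. -/
def shearForm (g₀ : Metric E M) (η ξ : VField E M) (t : ℝ) (x : M) :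
    TangentSpace 𝓘(ℝ, E) x →L[ℝ] TangentSpace 𝓘(ℝ, E) x →L[ℝ] ℝ :=
  (ContinuousLinearMap.precomp ℝ (shear g₀ η ξ t x)) ∘L (g₀.inner x) ∘L (shear g₀ η ξ t x)

lemma shearForm_apply (v w : TangentSpace 𝓘(ℝ, E) x) :
    shearForm g₀ η ξ t x v w
      = g₀.inner x (shear g₀ η ξ t x v) (shear g₀ η ξ t x w) := rfl

lemma contMDiff_shearForm (hη : Smooth η) (hξ : Smooth ξ) :
    ContMDiff (𝓘(ℝ, ℝ).prod 𝓘(ℝ, E)) (𝓘(ℝ, E).prod 𝓘(ℝ, E →L[ℝ] E →L[ℝ] ℝ)) ∞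
      (fun p : ℝ × M ↦ (TotalSpace.mk' (E →L[ℝ] E →L[ℝ] ℝ) p.2 (shearForm g₀ η ξ p.1 p.2) :
        TotalSpace (E →L[ℝ] E →L[ℝ] ℝ)
          (fun x : M ↦ TangentSpace 𝓘(ℝ, E) x →L[ℝ] TangentSpace 𝓘(ℝ, E) x →L[ℝ] ℝ))) := by
  intro p
  refine contMDiffAt_bilin_of_apply (h := fun q : ℝ × M ↦ q.2) contMDiffAt_snd fun v w hv hw ↦ ?_
  have hg : ContMDiffAt (𝓘(ℝ, ℝ).prod 𝓘(ℝ, E)) (𝓘(ℝ, E).prod 𝓘(ℝ, E →L[ℝ] E →L[ℝ] ℝ)) ∞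
      (fun q : ℝ × M ↦ (TotalSpace.mk' (E →L[ℝ] E →L[ℝ] ℝ) q.2 (g₀.inner q.2) :
        TotalSpace (E →L[ℝ] E →L[ℝ] ℝ)
          (fun x : M ↦ TangentSpace 𝓘(ℝ, E) x →L[ℝ] TangentSpace 𝓘(ℝ, E) x →L[ℝ] ℝ))) p :=
    g₀.contMDiff.contMDiffAt.comp p contMDiffAt_snd
  have hη' : ContMDiffAt (𝓘(ℝ, ℝ).prod 𝓘(ℝ, E)) 𝓘(ℝ, E).tangent ∞
      (fun q : ℝ × M ↦ TotalSpace.mk' E q.2 (η q.2)) p :=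
    (SmoothOn.contMDiffAt hη isOpen_univ (mem_univ _)).comp p contMDiffAt_snd
  have hξ' : ContMDiffAt (𝓘(ℝ, ℝ).prod 𝓘(ℝ, E)) 𝓘(ℝ, E).tangent ∞
      (fun q : ℝ × M ↦ TotalSpace.mk' E q.2 (ξ q.2)) p :=
    (SmoothOn.contMDiffAt hξ isOpen_univ (mem_univ _)).comp p contMDiffAt_snd
  have ht : ContMDiffAt (𝓘(ℝ, ℝ).prod 𝓘(ℝ, E)) 𝓘(ℝ, ℝ) ∞ (fun q : ℝ × M ↦ q.1) p :=
    contMDiffAt_fst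
  have h1 := ((contMDiffAt_bilin_apply hg hv hw).sub
    (ht.mul ((contMDiffAt_bilin_apply hg hη' hw).mul (contMDiffAt_bilin_apply hg hv hξ')))).sub
    (ht.mul ((contMDiffAt_bilin_apply hg hη' hv).mul ((contMDiffAt_bilin_apply hg hξ' hw).sub
      (ht.mul ((contMDiffAt_bilin_apply hg hη' hw).mul (contMDiffAt_bilin_apply hg hξ' hξ'))))))
  refine h1.congr_of_eventuallyEq (.of_forall fun q ↦ ?_)
  simp [shearForm_apply]

/-- The metric obtained from `g₀` by tilting the horizontal spaces in the direction of `ξ`. -/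
def shearMetric (g₀ : Metric E M) (hη : Smooth η) (hξ : Smooth ξ)
    (h : ∀ x, g₀.inner x (η x) (ξ x) = 0) (t : ℝ) : Metric E M where
  inner := shearForm g₀ η ξ t
  symm x v w := g₀.symm x _ _
  pos x v hv := g₀.pos x (shear g₀ η ξ t x v) fun h0 ↦ hv <| by
    rw [← shear_neg_shear (t := t) (h x) v, h0, map_zero]
  isVonNBounded x := by
    refine ((g₀.isVonNBounded x).image (shear g₀ η ξ (-t) x)).subset fun v hv ↦ ?_
    exact ⟨shear g₀ η ξ t x v, hv, shear_neg_shear (h x) v⟩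
  contMDiff := (contMDiff_shearForm hη hξ).comp (contMDiff_const.prodMk contMDiff_id)

variable {F : Type*} [NormedAddCommGroup F] [NormedSpace ℝ F] [FiniteDimensional ℝ F]
  {N : Type*} [TopologicalSpace N] [ChartedSpace F N] [IsManifold 𝓘(ℝ, F) ∞ N]
  {gN : Metric F N} {pr : M → N} {hη : Smooth η} {hξ : Smooth ξ}
  {h : ∀ x, g₀.inner x (η x) (ξ x) = 0}

lemma shearMetric_inner (v w : TangentSpace 𝓘(ℝ, E) x) :
    (shearMetric g₀ hη hξ h t).inner x v w
      = g₀.inner x (shear g₀ η ξ t x v) (shear g₀ η ξ t x w) := rfl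

lemma shear_of_vert (hη : ∀ x, η x ∈ horiz F g₀ pr x) {v : TangentSpace 𝓘(ℝ, E) x}
    (hv : v ∈ vert E F pr x) : shear g₀ η ξ t x v = v := by
  have := mem_horiz.1 (hη x) v hv
  rw [g₀.symm] at this
  simp [this]

lemma mfderiv_shear (hξ : ∀ x, ξ x ∈ vert E F pr x) (v : TangentSpace 𝓘(ℝ, E) x) :
    mfderiv 𝓘(ℝ, E) 𝓘(ℝ, F) pr x (shear g₀ η ξ t x v) = mfderiv 𝓘(ℝ, E) 𝓘(ℝ, F) pr x v := by
  simp [mem_vert.1 (hξ x)]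

lemma mem_horiz_shearMetric (hηh : ∀ x, η x ∈ horiz F g₀ pr x) {v : TangentSpace 𝓘(ℝ, E) x} :
    v ∈ horiz F (shearMetric g₀ hη hξ h t) pr x ↔ shear g₀ η ξ t x v ∈ horiz F g₀ pr x := by
  simp only [mem_horiz, shearMetric_inner]
  exact forall₂_congr fun u hu ↦ by rw [shear_of_vert hηh hu]

lemma IsRiemannianSubmersion.shearMetric (hg : IsRiemannianSubmersion g₀ gN pr)
    (hηh : ∀ x, η x ∈ horiz F g₀ pr x) (hξv : ∀ x, ξ x ∈ vert E F pr x) :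
    IsRiemannianSubmersion (shearMetric g₀ hη hξ h t) gN pr where
  smooth := hg.smooth
  surjective := hg.surjective
  isometry x v hv w hw := by
    rw [shearMetric_inner, hg.isometry x _ ((mem_horiz_shearMetric hηh).1 hv) _
      ((mem_horiz_shearMetric hηh).1 hw), mfderiv_shear hξv, mfderiv_shear hξv]

lemma IsRiemannianSubmersion.liftVec_shearMetric (hg : IsRiemannianSubmersion g₀ gN pr)
    (hηh : ∀ x, η x ∈ horiz F g₀ pr x) (hξv : ∀ x, ξ x ∈ vert E F pr x)
    (w : TangentSpace 𝓘(ℝ, F) (pr x)) :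
    liftVec F (RiemSubm.shearMetric g₀ hη hξ h t) pr x w
      = liftVec F g₀ pr x w + (t * g₀.inner x (η x) (liftVec F g₀ pr x w)) • ξ x := by
  have e : liftVec F g₀ pr x w + (t * g₀.inner x (η x) (liftVec F g₀ pr x w)) • ξ x
      = shear g₀ η ξ (-t) x (liftVec F g₀ pr x w) := by
    rw [shear_apply]
    module
  rw [e]
  refine eq_of_mem_horiz (liftVec_mem _) ((mem_horiz_shearMetric hηh).2 ?_) ?_
  · have := shear_neg_shear (t := -t) (h x) (liftVec F g₀ pr x w)
    rw [neg_neg] at this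
    rw [this]
    exact liftVec_mem w
  · rw [(hg.shearMetric hηh hξv).mfderiv_liftVec, mfderiv_shear hξv, hg.mfderiv_liftVec]

/-- A nonzero vertical field which is a Killing field on the fibers yields a nontrivial
variation through Riemannian submersions with totally geodesic fibers. -/
lemma exists_variation_of_killing [T2Space N] (hN : 0 < Module.finrank ℝ F)
    (hg₀ : IsRiemannianSubmersion g₀ gN pr) (hT : TotallyGeodesicFibers F g₀ pr)
    (hξ : IsVerticalField F pr ξ) (hne : ∃ x, ξ x ≠ 0)
    (hK : ∀ y : N, IsKillingOnFiber F g₀ pr ξ y) :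
    ∃ (ε : ℝ) (g : ℝ → Metric E M), IsVariation F g₀ pr ε g ∧ NontrivialVariation g₀ ε g ∧
      ∀ t ∈ Ioo (-ε) ε, IsRiemannianSubmersion (g t) gN pr ∧ TotallyGeodesicFibers F (g t) pr := by
  obtain ⟨x₀, hx₀⟩ := hne
  obtain ⟨w, hw⟩ : ∃ w : TangentSpace 𝓘(ℝ, F) (pr x₀), w ≠ 0 := by
    have : Nontrivial F := Module.finrank_pos_iff.1 hN
    exact exists_ne (0 : F)
  obtain ⟨W₀, hW₀, hW₀x⟩ := exists_smooth_eq w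
  set η := horizLift g₀ pr W₀
  have hη : Smooth η := hg₀.smooth_horizLift hW₀
  have hηh : ∀ x, η x ∈ horiz F g₀ pr x := fun x ↦ liftVec_mem _
  have hξv : ∀ x, ξ x ∈ vert E F pr x := fun x ↦ hξ.2 x (mem_univ x)
  have h : ∀ x, g₀.inner x (η x) (ξ x) = 0 := fun x ↦ by
    rw [g₀.symm]
    exact mem_horiz.1 (hηh x) _ (hξv x)
  have hvert : ∀ t x, ∀ v ∈ vert E F pr x, ∀ w ∈ vert E F pr x,
      (shearMetric g₀ hη hξ.1 h t).inner x v w = g₀.inner x v w := fun t x v hv w hw ↦ by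
    rw [shearMetric_inner, shear_of_vert hηh hv, shear_of_vert hηh hw]
  have hsub : ∀ t, IsRiemannianSubmersion (shearMetric g₀ hη hξ.1 h t) gN pr :=
    fun t ↦ hg₀.shearMetric hηh hξv
  refine ⟨1, shearMetric g₀ hη hξ.1 h, ⟨one_pos, (contMDiff_shearForm hη hξ.1).contMDiffOn,
    Metric.ext fun x v w ↦ by simp [shearMetric_inner], fun t _ ↦ hvert t⟩,
    ⟨1 / 2, by norm_num, fun heq ↦ ?_⟩, fun t _ ↦ ⟨hsub t, ?_⟩⟩
  · have h1 : (shearMetric g₀ hη hξ.1 h (1 / 2)).inner x₀ (ξ x₀) (η x₀)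
        = g₀.inner x₀ (ξ x₀) (η x₀) := by rw [heq]
    have h2 : g₀.inner x₀ (η x₀) (η x₀) = gN.inner (pr x₀) w w := by
      rw [← hW₀x]
      exact hg₀.inner_liftVec_liftVec _ _
    have h3 := gN.pos _ _ hw
    have h4 := g₀.pos _ _ hx₀
    rw [shearMetric_inner, shear_of_vert hηh (hξv x₀), shear_apply, h2] at h1
    simp only [map_sub, map_smul, smul_eq_mul] at h1
    nlinarith [mul_pos h3 h4]
  · rw [(hsub t).totallyGeodesicFibers_iff (hvert t)]
    intro W hW X Y hX hY x
    have e : horizLift (shearMetric g₀ hη hξ.1 h t) pr W = horizLift g₀ pr W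
        + (fun y ↦ (fun z ↦ t * gN.inner z (W₀ z) (W z)) (pr y)) • ξ := by
      funext y
      rw [horizLift_apply, hg₀.liftVec_shearMetric hηh hξv]
      congr 2
      exact congrArg (t * ·) (hg₀.inner_liftVec_liftVec _ _)
    have hc : MDiffAt (fun z ↦ t * gN.inner z (W₀ z) (W z)) (pr x) :=
      mdifferentiableAt_const.mul (mdiffAt_inner gN
        (SmoothOn.mdiffAt hW₀ isOpen_univ (mem_univ _))
        (SmoothOn.mdiffAt hW isOpen_univ (mem_univ _)))
    have hprd : MDifferentiableAt 𝓘(ℝ, E) 𝓘(ℝ, F) pr x :=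
      (hg₀.smooth x).mdifferentiableAt (by simp)
    have hξd : MDiffAt (T% ξ) x := SmoothOn.mdiffAt hξ.1 isOpen_univ (mem_univ _)
    have hc' : MDiffAt (fun y ↦ (fun z ↦ t * gN.inner z (W₀ z) (W z)) (pr y)) x := hc.comp x hprd
    rw [e, lieDerivMetric_add (SmoothOn.mdiffAt (hg₀.smooth_horizLift hW) isOpen_univ (mem_univ _))
      (hc'.smul_section hξd),
      (hg₀.totallyGeodesicFibers_iff fun _ _ _ _ _ ↦ rfl).1 hT W hW X Y hX hY,
      lieDerivMetric_smul_of_vert hprd hc hξd (hX.2 x (mem_univ x)) (hY.2 x (mem_univ x)),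
      hK (pr x) X Y hX hY x rfl]
    simp

end Shear

section Calculus

variable {E : Type*} [NormedAddCommGroup E] [NormedSpace ℝ E] {t : ℝ}

lemma hasDerivAt_sum_smul {ι : Type*} [Fintype ι] {b : ι → ℝ → ℝ} {b' : ι → ℝ} {z : ι → ℝ → E}
    {z' : ι → E} (hb : ∀ i, HasDerivAt (b i) (b' i) t) (hz : ∀ i, HasDerivAt (z i) (z' i) t) :
    HasDerivAt (fun s ↦ ∑ i, b i s • z i s) (∑ i, (b i t • z' i + b' i • z i t)) t :=
  HasDerivAt.fun_sum fun i _ ↦ (hb i).smul (hz i)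

lemma hasDerivAt_clm_apply [FiniteDimensional ℝ E] {c : ℝ → E →L[ℝ] ℝ} {u : ℝ → E} {u' : E}
    (hc : ∀ v, ContDiffAt ℝ ∞ (fun s ↦ c s v) t) (hu : HasDerivAt u u' t) :
    HasDerivAt (fun s ↦ c s (u s)) (deriv c t (u t) + c t u') t := by
  have h1 : ContMDiffAt 𝓘(ℝ, ℝ) 𝓘(ℝ, E →L[ℝ] ℝ) ∞ c t :=
    contMDiffAt_clm_of_apply fun v ↦ (hc v).contMDiffAt
  exact (h1.contDiffAt.differentiableAt (by simp)).hasDerivAt.clm_apply hu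

lemma hasDerivAt_clm_comp {G : Type*} [NormedAddCommGroup G] [NormedSpace ℝ G] (c : E →L[ℝ] G)
    {u : ℝ → E} {u' : E} (hu : HasDerivAt u u' t) : HasDerivAt (fun s ↦ c (u s)) (c u') t :=
  c.hasFDerivAt.comp_hasDerivAt t hu

end Calculus

section Variation

variable {E : Type*} [NormedAddCommGroup E] [NormedSpace ℝ E] [FiniteDimensional ℝ E]
  {M : Type*} [TopologicalSpace M] [ChartedSpace E M] [IsManifold 𝓘(ℝ, E) ∞ M]
  {F : Type*} [NormedAddCommGroup F] [NormedSpace ℝ F] [FiniteDimensional ℝ F]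
  {N : Type*} [TopologicalSpace N] [ChartedSpace F N] [IsManifold 𝓘(ℝ, F) ∞ N]
  {g₀ : Metric E M} {gN : Metric F N} {pr : M → N} {X Y Z : VField E M} {x : M}
  {ε t : ℝ} {g : ℝ → Metric E M} {U : Set N}

lemma SmoothFamily.contMDiffAt (hg : SmoothFamily ε g) (ht : t ∈ Ioo (-ε) ε) :
    ContMDiffAt (𝓘(ℝ, ℝ).prod 𝓘(ℝ, E)) (𝓘(ℝ, E).prod 𝓘(ℝ, E →L[ℝ] E →L[ℝ] ℝ)) ∞
    (fun p : ℝ × M ↦ (TotalSpace.mk' (E →L[ℝ] E →L[ℝ] ℝ) p.2 ((g p.1).inner p.2) :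
      TotalSpace (E →L[ℝ] E →L[ℝ] ℝ)
        (fun x : M ↦ TangentSpace 𝓘(ℝ, E) x →L[ℝ] TangentSpace 𝓘(ℝ, E) x →L[ℝ] ℝ))) (t, x) :=
  ContMDiffWithinAt.contMDiffAt (hg (t, x) ⟨ht, mem_univ x⟩)
    ((isOpen_Ioo.prod isOpen_univ).mem_nhds ⟨ht, mem_univ x⟩)

lemma contMDiffAt_horizLift_family (hg : SmoothFamily ε g)
    (hsub : ∀ t ∈ Ioo (-ε) ε, IsRiemannianSubmersion (g t) gN pr) (ht : t ∈ Ioo (-ε) ε)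
    {W : VField F N} (hU : IsOpen U) (hW : SmoothOn W U) (hx : x ∈ pr ⁻¹' U) :
    ContMDiffAt (𝓘(ℝ, ℝ).prod 𝓘(ℝ, E)) 𝓘(ℝ, E).tangent ∞
      (fun p : ℝ × M ↦ TotalSpace.mk' E p.2 (horizLift (g p.1) pr W p.2)) (t, x) := by
  refine contMDiffAt_horizLift (h := fun p : ℝ × M ↦ p.2) (G := fun p ↦ g p.1) (gN := gN)
    (hg.contMDiffAt ht) ?_ (hW.contMDiffAt hU hx)
  have : ∀ᶠ p : ℝ × M in 𝓝 (t, x), p.1 ∈ Ioo (-ε) ε :=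
    continuous_fst.continuousAt (isOpen_Ioo.mem_nhds ht)
  filter_upwards [this] with p hp
  exact hsub _ hp

/-- The derivative of the horizontal lift of a vector field in a variation of metrics. -/
lemma hasDerivAt_horizLift {ι : Type*} [Fintype ι] (hg : IsVariation F g₀ pr ε g)
    (hsub : ∀ t ∈ Ioo (-ε) ε, IsRiemannianSubmersion (g t) gN pr) (ht : t ∈ Ioo (-ε) ε)
    (hU : IsOpen U) {W : ι → VField F N} (hW : ∀ i, SmoothOn (W i) U) (hx : x ∈ pr ⁻¹' U)
    {v : ι → TangentSpace 𝓘(ℝ, E) x} (hv : ∀ i, v i ∈ vert E F pr x)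
    (hB : ∀ X ∈ vert E F pr x, Bsharp g t x X = ∑ i, g₀.inner x (v i) X •
      horizProj F (g t) pr x (horizLift g₀ pr (W i) x)) (j : ι) :
    HasDerivAt (fun s ↦ horizLift (g s) pr (W j) x)
      (∑ i, (-gN.inner (pr x) (W i (pr x)) (W j (pr x))) • v i) t := by
  have hIoo : ∀ᶠ s in 𝓝 t, s ∈ Ioo (-ε) ε := isOpen_Ioo.mem_nhds ht
  have hcurve : ContMDiffAt 𝓘(ℝ, ℝ) (𝓘(ℝ, ℝ).prod 𝓘(ℝ, E)) ∞ (fun s : ℝ ↦ (s, x)) t :=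
    contMDiffAt_id.prodMk contMDiffAt_const
  have hlift : ContMDiffAt 𝓘(ℝ, ℝ) 𝓘(ℝ, E).tangent ∞
      (fun s ↦ TotalSpace.mk' E x (horizLift (g s) pr (W j) x)) t :=
    (contMDiffAt_horizLift_family hg.smooth hsub ht hU (hW j) hx).comp (f := fun s : ℝ ↦ (s, x))
      t hcurve
  obtain ⟨D, hD⟩ := differentiableAt_of_contMDiffAt_mk hlift
  have hDv : D ∈ vert E F pr x := by
    have h1 := hasDerivAt_clm_comp (E := E) (G := F) (mfderiv 𝓘(ℝ, E) 𝓘(ℝ, F) pr x) hD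
    have h2 : HasDerivAt (F := F) (fun s ↦ mfderiv 𝓘(ℝ, E) 𝓘(ℝ, F) pr x
        (horizLift (g s) pr (W j) x)) (0 : F) t := by
      refine (hasDerivAt_const (F := F) t (W j (pr x))).congr_of_eventuallyEq ?_
      filter_upwards [hIoo] with s hs
      exact (hsub s hs).mfderiv_liftVec _
    exact h1.unique h2
  have hDB : ∀ X ∈ vert E F pr x, g₀.inner x X D
      = g₀.inner x X (∑ i, (-gN.inner (pr x) (W i (pr x)) (W j (pr x))) • v i) := by
    intro X hX
    have hc : ∀ w : TangentSpace 𝓘(ℝ, E) x, ContDiffAt ℝ ∞ (fun s ↦ (g s).inner x X w) t := by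
      intro w
      have h1 := (hg.smooth.contMDiffAt (x := x) ht).comp t hcurve
      exact (contMDiffAt_bilin_apply (h := fun _ : ℝ ↦ x) (v := fun _ ↦ X) (w := fun _ ↦ w) h1
        contMDiffAt_const contMDiffAt_const).contDiffAt
    have h1 := hasDerivAt_clm_apply (E := E) (c := fun s ↦ (g s).inner x X) hc hD
    have h2 : HasDerivAt (fun s ↦ (g s).inner x X (horizLift (g s) pr (W j) x)) 0 t := by
      refine (hasDerivAt_const t (0 : ℝ)).congr_of_eventuallyEq ?_
      filter_upwards [hIoo] with s _
      exact mem_horiz.1 (liftVec_mem _) X hX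
    have h3 := h1.unique h2
    have h4 : (g t).inner x (Bsharp g t x X) (horizLift (g t) pr (W j) x)
        = (deriv (fun s ↦ (g s).inner x X) t : TangentSpace 𝓘(ℝ, E) x →L[ℝ] ℝ)
          (horizLift (g t) pr (W j) x) := inner_sharp _ _ _ _
    have h5 : (g t).inner x (Bsharp g t x X) (horizLift (g t) pr (W j) x)
        = ∑ i, g₀.inner x X (v i) * gN.inner (pr x) (W i (pr x)) (W j (pr x)) := by
      have hg₀ : IsRiemannianSubmersion g₀ gN pr := by
        have := hsub 0 ⟨neg_lt_zero.2 hg.pos, hg.pos⟩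
        rwa [hg.zero] at this
      rw [hB X hX, map_sum, sum_apply]
      refine Finset.sum_congr rfl fun i _ ↦ ?_
      rw [map_smul, smul_apply, smul_eq_mul, g₀.symm, (hsub t ht).horizProj_eq_liftVec,
        horizLift_apply, hg₀.mfderiv_liftVec, horizLift_apply, (hsub t ht).inner_liftVec_liftVec]
    have h6 : (g t).inner x X D = g₀.inner x X D := hg.vertical t ht x X hX D hDv
    have h7 : ∑ i, g₀.inner x X (v i) * gN.inner (pr x) (W i (pr x)) (W j (pr x))
        + g₀.inner x X D = 0 := by
      rw [← h5, h4, ← h6]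
      exact h3
    rw [map_sum, eq_neg_of_add_eq_zero_right h7, ← Finset.sum_neg_distrib]
    refine Finset.sum_congr rfl fun i _ ↦ ?_
    rw [map_smul, smul_eq_mul]
    ring
  have hmem : D - ∑ i, (-gN.inner (pr x) (W i (pr x)) (W j (pr x))) • v i ∈ vert E F pr x :=
    sub_mem hDv (sum_mem fun i _ ↦ Submodule.smul_mem _ _ (hv i))
  have hzero : D - ∑ i, (-gN.inner (pr x) (W i (pr x)) (W j (pr x))) • v i = 0 := by
    by_contra hne
    refine (g₀.pos x _ hne).ne' ?_
    rw [map_sub (g₀.inner x _), hDB _ hmem, sub_self]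
  rwa [sub_eq_zero.1 hzero] at hD

lemma mdiffAt_sum {ι : Type*} (f : Finset ι) {Z : ι → VField E M}
    (hZ : ∀ i, MDiffAt (T% (Z i)) x) : MDiffAt (T% (∑ i ∈ f, Z i)) x := by
  have := MDifferentiableAt.sum_section (s := f) fun i _ ↦ hZ i
  convert! this using 3
  simp

lemma lieDerivMetric_sum {ι : Type*} (f : Finset ι) {Z : ι → VField E M}
    (hZ : ∀ i, MDiffAt (T% (Z i)) x) :
    lieDerivMetric g₀ (∑ i ∈ f, Z i) X Y x = ∑ i ∈ f, lieDerivMetric g₀ (Z i) X Y x := by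
  classical
  induction f using Finset.induction_on with
  | empty => simp [lieDerivMetric]
  | insert i f hi ih =>
    rw [Finset.sum_insert hi, Finset.sum_insert hi,
      lieDerivMetric_add (hZ i) (mdiffAt_sum f hZ), ih]

/-- The Lie derivative of a metric along a smooth family of vector fields can be differentiated in
the parameter. -/
lemma hasDerivAt_lieDerivMetric {Z : ℝ → VField E M} {Z' : VField E M}
    (hX : ContMDiffAt 𝓘(ℝ, E) 𝓘(ℝ, E).tangent ∞ (T% X) x)
    (hY : ContMDiffAt 𝓘(ℝ, E) 𝓘(ℝ, E).tangent ∞ (T% Y) x)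
    (hZ : ContMDiffAt (𝓘(ℝ, ℝ).prod 𝓘(ℝ, E)) 𝓘(ℝ, E).tangent ∞
      (fun p : ℝ × M ↦ TotalSpace.mk' E p.2 (Z p.1 p.2)) (t, x))
    (hZs : ∀ᶠ s in 𝓝 t, MDiffAt (T% (Z s)) x) (hZ'd : MDiffAt (T% Z') x)
    (hZ' : ∀ᶠ y in 𝓝 x, HasDerivAt (fun s ↦ Z s y) (Z' y) t) :
    HasDerivAt (fun s ↦ lieDerivMetric g₀ (Z s) X Y x) (lieDerivMetric g₀ Z' X Y x) t := by
  have hXd : MDiffAt (T% X) x := hX.mdifferentiableAt (by simp)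
  have hYd : MDiffAt (T% Y) x := hY.mdifferentiableAt (by simp)
  have key : ∀ {V : VField E M}, ContMDiffAt 𝓘(ℝ, E) 𝓘(ℝ, E).tangent ∞ (T% V) x →
      ∀ v, HasDerivAt (fun s ↦ dInner g₀ (Z s) V x v) (dInner g₀ Z' V x v) t := by
    intro V hV v
    refine hasDerivAt_mvfderiv_comm (f := fun p : ℝ × M ↦ g₀.inner p.2 (Z p.1 p.2) (V p.2)) ?_ ?_
      (mdiffAt_inner g₀ hZ'd (hV.mdifferentiableAt (by simp))) v
    · exact contMDiffAt_bilin_apply (h := fun p : ℝ × M ↦ p.2)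
        (g₀.contMDiff.contMDiffAt.comp (t, x) contMDiffAt_snd) hZ
        (ContMDiffAt.comp (t, x) hV contMDiffAt_snd)
    · filter_upwards [hZ'] with y hy
      have := hasDerivAt_clm_comp (E := E) (G := ℝ) (g₀.inner y (V y)) hy
      simp only [g₀.symm y _ (V y)]
      exact this
  have h3 := hasDerivAt_clm_comp (E := E) (G := ℝ)
    (g₀.inner x (leviCivita g₀ Y x (X x) + leviCivita g₀ X x (Y x))) hZ'.self_of_nhds
  have h4 := ((key hY (X x)).add (key hX (Y x))).sub h3
  rw [lieDerivMetric_eq_leviCivita hXd hYd hZ'd, g₀.symm x (Z' x)]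
  refine h4.congr_of_eventuallyEq ?_
  filter_upwards [hZs] with s hs
  rw [lieDerivMetric_eq_leviCivita hXd hYd hs, g₀.symm x (Z s x)]
  rfl

lemma exists_dual_frame {y : N} {w : Fin (Module.finrank ℝ F) → TangentSpace 𝓘(ℝ, F) y}
    (hw : LinearIndependent ℝ w) : ∃ w' : Fin (Module.finrank ℝ F) → TangentSpace 𝓘(ℝ, F) y,
      ∀ u, ∑ j, gN.inner y u (w j) • w' j = u := by
  have hcard : Fintype.card (Fin (Module.finrank ℝ F))
      = Module.finrank ℝ (TangentSpace 𝓘(ℝ, F) y) := Fintype.card_fin _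
  let b := Module.Basis.mk hw (by
    rw [hw.span_eq_top_of_card_eq_finrank' hcard])
  refine ⟨(bilin gN y).dualBasis (bilin_nondegenerate gN y) b, fun u ↦ ?_⟩
  conv_rhs => rw [← ((bilin gN y).dualBasis (bilin_nondegenerate gN y) b).sum_repr u]
  simp [b]

/-- The derivative of the second fundamental form in a variation of metrics. -/
lemma exists_hasDerivAt_secondFF (hg : IsVariation F g₀ pr ε g)
    (hsub : ∀ t ∈ Ioo (-ε) ε, IsRiemannianSubmersion (g t) gN pr) (hU : IsOpen U)
    {W : Fin (Module.finrank ℝ F) → VField F N} {V : Fin (Module.finrank ℝ F) → VField E M}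
    (hW : ∀ i, SmoothOn (W i) U) (hWli : ∀ y ∈ U, LinearIndependent ℝ fun i ↦ W i y)
    (ht : t ∈ Ioo (-ε) ε) (hVs : ∀ i, SmoothOn (V i) (pr ⁻¹' U))
    (hV : ∀ i, IsVerticalOn F pr (V i) (pr ⁻¹' U))
    (hB : ∀ x ∈ pr ⁻¹' U, ∀ X ∈ vert E F pr x, Bsharp g t x X = ∑ i, g₀.inner x (V i x) X •
      horizProj F (g t) pr x (horizLift g₀ pr (W i) x))
    (hXs : SmoothOn X (pr ⁻¹' U)) (hX : IsVerticalOn F pr X (pr ⁻¹' U))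
    (hYs : SmoothOn Y (pr ⁻¹' U)) (hY : IsVerticalOn F pr Y (pr ⁻¹' U)) (hx : x ∈ pr ⁻¹' U) :
    ∃ D : TangentSpace 𝓘(ℝ, E) x, HasDerivAt (fun s ↦ secondFF F (g s) pr X Y x) D t ∧
      horizProj F (g t) pr x D = (1 / 2 : ℝ) • ∑ i, lieDerivMetric g₀ (V i) X Y x •
        horizProj F (g t) pr x (horizLift g₀ pr (W i) x) := by
  have hg₀ : IsRiemannianSubmersion g₀ gN pr := by
    have := hsub 0 ⟨neg_lt_zero.2 hg.pos, hg.pos⟩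
    rwa [hg.zero] at this
  have hgt := hsub t ht
  have hO : IsOpen (pr ⁻¹' U) := hU.preimage hg₀.smooth.continuous
  have hIoo : ∀ᶠ s in 𝓝 t, s ∈ Ioo (-ε) ε := isOpen_Ioo.mem_nhds ht
  have hprd : MDifferentiableAt 𝓘(ℝ, E) 𝓘(ℝ, F) pr x := (hg₀.smooth x).mdifferentiableAt (by simp)
  obtain ⟨w', hw'⟩ := exists_dual_frame (gN := gN) (hWli (pr x) hx)
  set ℓ : Fin (Module.finrank ℝ F) → ℝ := fun i ↦ lieDerivMetric g₀ (V i) X Y x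
  set Z' : Fin (Module.finrank ℝ F) → VField E M := fun j ↦
    ∑ i, (fun y ↦ (fun z ↦ -gN.inner z (W i z) (W j z)) (pr y)) • V i
  have hZ' : ∀ j, ∀ y ∈ pr ⁻¹' U, HasDerivAt (fun s ↦ horizLift (g s) pr (W j) y) (Z' j y) t := by
    intro j y hy
    have := hasDerivAt_horizLift hg hsub ht hU hW hy (fun i ↦ hV i y hy) (hB y hy) j
    convert! this using 1
    simp [Z']
  have hc : ∀ i j, MDiffAt (fun z ↦ -gN.inner z (W i z) (W j z)) (pr x) := fun i j ↦
    (mdiffAt_inner gN ((hW i).mdiffAt hU hx) ((hW j).mdiffAt hU hx)).neg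
  have hVd : ∀ i, MDiffAt (T% (V i)) x := fun i ↦ (hVs i).mdiffAt hO hx
  have hcV : ∀ i j, MDiffAt
      (T% ((fun y ↦ (fun z ↦ -gN.inner z (W i z) (W j z)) (pr y)) • V i)) x := fun i j ↦ by
    have : MDiffAt (fun y ↦ (fun z ↦ -gN.inner z (W i z) (W j z)) (pr y)) x := (hc i j).comp x hprd
    exact this.smul_section (hVd i)
  have hZ'd : ∀ j, MDiffAt (T% (Z' j)) x := fun j ↦ mdiffAt_sum _ fun i ↦ hcV i j
  have hL : ∀ j, lieDerivMetric g₀ (Z' j) X Y x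
      = -∑ i, ℓ i * gN.inner (pr x) (W i (pr x)) (W j (pr x)) := by
    intro j
    rw [lieDerivMetric_sum _ fun i ↦ hcV i j, ← Finset.sum_neg_distrib]
    refine Finset.sum_congr rfl fun i _ ↦ ?_
    rw [lieDerivMetric_smul_of_vert hprd (hc i j) (hVd i) (hX x hx) (hY x hx)]
    ring
  set b : Fin (Module.finrank ℝ F) → ℝ → ℝ := fun j s ↦
    -(1 / 2) * lieDerivMetric g₀ (horizLift (g s) pr (W j)) X Y x
  obtain ⟨u, hu⟩ : ∃ u, u = (1 / 2 : ℝ) • ∑ i, ℓ i • W i (pr x) := ⟨_, rfl⟩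
  have hb : ∀ j, HasDerivAt (b j) (gN.inner (pr x) u (W j (pr x))) t := by
    intro j
    have h1 := hasDerivAt_lieDerivMetric (g₀ := g₀) (hXs.contMDiffAt hO hx)
      (hYs.contMDiffAt hO hx) (contMDiffAt_horizLift_family hg.smooth hsub ht hU (hW j) hx)
      (hIoo.mono fun s hs ↦ ((hsub s hs).smoothOn_horizLift hU (hW j)).mdiffAt hO hx) (hZ'd j)
      (Filter.mem_of_superset (hO.mem_nhds hx) (hZ' j))
    refine (h1.const_mul (-(1 / 2))).congr_deriv ?_
    rw [hL j, hu]
    simp [Finset.mul_sum, sum_apply]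
  have hlift : ∀ k, ∃ D' ∈ vert E F pr x,
      HasDerivAt (fun s ↦ liftVec F (g s) pr x (w' k)) D' t := by
    intro k
    have hspan : w' k ∈ Submodule.span ℝ (range fun i ↦ W i (pr x)) := by
      rw [(hWli (pr x) hx).span_eq_top_of_card_eq_finrank' (Fintype.card_fin _)]
      trivial
    obtain ⟨a, ha⟩ := (Submodule.mem_span_range_iff_exists_fun ℝ).1 hspan
    refine ⟨∑ i, (a i • Z' i x + (0 : ℝ) • horizLift (g t) pr (W i) x), sum_mem fun i _ ↦ ?_,
      HasDerivAt.congr_of_eventuallyEq (F := E) (hasDerivAt_sum_smul (E := E)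
        (fun i ↦ hasDerivAt_const t (a i)) fun i ↦ hZ' i x hx) ?_⟩
    · rw [zero_smul, add_zero]
      simp only [Z', Finset.sum_apply]
      exact Submodule.smul_mem _ _ (sum_mem fun j _ ↦ Submodule.smul_mem _ _ (hV j x hx))
    · filter_upwards [hIoo] with s hs
      rw [← ha, (hsub s hs).liftVec_sum]
      exact Finset.sum_congr rfl fun i _ ↦ (hsub s hs).liftVec_smul _ _
  choose D' hD'v hD' using hlift
  have hsum : (fun s ↦ secondFF F (g s) pr X Y x) =ᶠ[𝓝 t]
      fun s ↦ ∑ j, b j s • liftVec F (g s) pr x (w' j) := by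
    filter_upwards [hIoo] with s hs
    have h1 : ∀ j, b j s = gN.inner (pr x)
        (mfderiv 𝓘(ℝ, E) 𝓘(ℝ, F) pr x (secondFF F (g s) pr X Y x)) (W j (pr x)) := fun j ↦ by
      rw [gN.symm, ← (hsub s hs).inner_liftVec, (g s).symm]
      exact ((hsub s hs).inner_secondFF_horizLift hU hx (hg.vertical s hs) (hW j) hXs hX hYs
        hY).symm
    rw [(hsub s hs).eq_liftVec (v := secondFF F (g s) pr X Y x) (horizProj_mem _),
      ← hw' (mfderiv 𝓘(ℝ, E) 𝓘(ℝ, F) pr x (secondFF F (g s) pr X Y x)), (hsub s hs).liftVec_sum]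
    refine Finset.sum_congr rfl fun j _ ↦ ?_
    rw [(hsub s hs).liftVec_smul, ← h1]
  refine ⟨∑ j, (b j t • D' j + gN.inner (pr x) u (W j (pr x)) • liftVec F (g t) pr x (w' j)),
    HasDerivAt.congr_of_eventuallyEq (F := E) (hasDerivAt_sum_smul (E := E) hb hD') hsum, ?_⟩
  have hW' : ∀ i, horizProj F (g t) pr x (horizLift g₀ pr (W i) x)
      = liftVec F (g t) pr x (W i (pr x)) := fun i ↦ by
    rw [hgt.horizProj_eq_liftVec, horizLift_apply, hg₀.mfderiv_liftVec]
  simp only [hW', map_sum, map_add, map_smul, horizProj_eq_zero (hD'v _),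
    horizProj_eq_self (liftVec_mem _), smul_zero, zero_add]
  simp only [← hgt.liftVec_smul, ← hgt.liftVec_sum]
  rw [hw', hu]

end Variation

end RiemSubm

end

theorem theorem3p11
    {E : Type*} [NormedAddCommGroup E] [NormedSpace ℝ E] [FiniteDimensional ℝ E]
    {M : Type*} [TopologicalSpace M] [ChartedSpace E M] [IsManifold 𝓘(ℝ, E) ∞ M]
    [T2Space M] [SecondCountableTopology M] [ConnectedSpace M]
    {F : Type*} [NormedAddCommGroup F] [NormedSpace ℝ F] [FiniteDimensional ℝ F]
    {N : Type*} [TopologicalSpace N] [ChartedSpace F N] [IsManifold 𝓘(ℝ, F) ∞ N]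
    [T2Space N] [SecondCountableTopology N] [ConnectedSpace N]
    (hN : 0 < Module.finrank ℝ F)
    (g₀ : RiemSubm.Metric E M) (gN : RiemSubm.Metric F N) (pr : M → N)
    (hpr : RiemSubm.IsRiemannianSubmersion g₀ gN pr)
    (hgeod : RiemSubm.TotallyGeodesicFibers F g₀ pr) :
    -- a non-trivial variation with totally geodesic fibers gives a fiberwise Killing field
    ((∃ (ε : ℝ) (g : ℝ → RiemSubm.Metric E M), RiemSubm.IsVariation F g₀ pr ε g ∧
        RiemSubm.NontrivialVariation g₀ ε g ∧
        ∀ t ∈ Ioo (-ε) ε, RiemSubm.IsRiemannianSubmersion (g t) gN pr ∧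
          RiemSubm.TotallyGeodesicFibers F (g t) pr) →
      ∃ ξ : RiemSubm.VField E M, RiemSubm.IsVerticalField F pr ξ ∧ (∃ x, ξ x ≠ 0) ∧
        ∀ y : N, RiemSubm.IsKillingOnFiber F g₀ pr ξ y) ∧
    -- a bounded fiberwise Killing field gives such a variation
    ((∃ ξ : RiemSubm.VField E M, RiemSubm.IsVerticalField F pr ξ ∧ (∃ x, ξ x ≠ 0) ∧
        RiemSubm.IsBounded g₀ ξ ∧ ∀ y : N, RiemSubm.IsKillingOnFiber F g₀ pr ξ y) →
      ∃ (ε : ℝ) (g : ℝ → RiemSubm.Metric E M), RiemSubm.IsVariation F g₀ pr ε g ∧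
        RiemSubm.NontrivialVariation g₀ ε g ∧
        ∀ t ∈ Ioo (-ε) ε, RiemSubm.IsRiemannianSubmersion (g t) gN pr ∧
          RiemSubm.TotallyGeodesicFibers F (g t) pr) ∧
    -- the formula for the horizontal part of the derivative of the second fundamental form
    (∀ (ε : ℝ) (g : ℝ → RiemSubm.Metric E M), RiemSubm.IsVariation F g₀ pr ε g →
      (∀ t ∈ Ioo (-ε) ε, RiemSubm.IsRiemannianSubmersion (g t) gN pr) →
      ∀ (U : Set N) (W : Fin (Module.finrank ℝ F) → RiemSubm.VField F N)
        (V : Fin (Module.finrank ℝ F) → ℝ → RiemSubm.VField E M), IsOpen U →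
      (∀ i, RiemSubm.SmoothOn (W i) U) →
      (∀ y ∈ U, LinearIndependent ℝ (fun i ↦ W i y)) →
      (∀ i, ∀ t ∈ Ioo (-ε) ε, RiemSubm.SmoothOn (V i t) (pr ⁻¹' U) ∧
        RiemSubm.IsVerticalOn F pr (V i t) (pr ⁻¹' U)) →
      (∀ t ∈ Ioo (-ε) ε, ∀ x ∈ pr ⁻¹' U, ∀ X ∈ RiemSubm.vert E F pr x,
        RiemSubm.Bsharp g t x X = ∑ i, g₀.inner x (V i t x) X •
          RiemSubm.horizProj F (g t) pr x (RiemSubm.horizLift g₀ pr (W i) x)) →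
      ∀ X Y : RiemSubm.VField E M,
        RiemSubm.SmoothOn X (pr ⁻¹' U) → RiemSubm.IsVerticalOn F pr X (pr ⁻¹' U) →
        RiemSubm.SmoothOn Y (pr ⁻¹' U) → RiemSubm.IsVerticalOn F pr Y (pr ⁻¹' U) →
        ∀ t ∈ Ioo (-ε) ε, ∀ x ∈ pr ⁻¹' U, ∃ D : TangentSpace 𝓘(ℝ, E) x,
          HasDerivAt (fun s ↦ RiemSubm.secondFF F (g s) pr X Y x) D t ∧
          RiemSubm.horizProj F (g t) pr x D =
            (1 / 2 : ℝ) • ∑ i, RiemSubm.lieDerivMetric g₀ (V i t) X Y x •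
              RiemSubm.horizProj F (g t) pr x (RiemSubm.horizLift g₀ pr (W i) x)) := by
  refine ⟨?_, ?_, ?_⟩
  · rintro ⟨ε, g, hg, ⟨t, ht, hne⟩, H⟩
    exact RiemSubm.exists_killing_of_ne (H t ht).1 hpr hne (hg.vertical t ht) (H t ht).2 hgeod
  · rintro ⟨ξ, hξ, hne, -, hK⟩
    exact RiemSubm.exists_variation_of_killing hN hpr hgeod hξ hne hK
  · intro ε g hg hsub U W V hU hW hWli hV hB X Y hXs hX hYs hY t ht x hx
    exact RiemSubm.exists_hasDerivAt_secondFF hg hsub hU hW hWli ht (fun i ↦ (hV i t ht).1)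
      (fun i ↦ (hV i t ht).2) (fun x hx ↦ hB t ht x hx) hXs hX hYs hY hx
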